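/- Let $m\ge 0$, $s\ge 1$, and let $f:\mathbb{R}^m\to\mathbb{R}^m$ be of class $C^{2s}$. Let $t_0<T$ and let $y:[t_0,T]\to\mathbb{R}^m$ be a solution of $\dot y(t)=f(y(t))$, $t\in[t_0,T]$, $y(t_0)=y_0$. Let $(c_i,b_i)$, $i=1,\dots,k$, be an interpolatory quadrature on $[0,1]$ with distinct real abscissae $c_i$ (i.e. $b_i$ is the integral over $[0,1]$ of the $i$-th Lagrange basis polynomial), of order $q\ge 2s$, i.e. exact for all polynomials of degree at most $q-1$. Let $P_0,P_1,\dots$ be the Legendre polynomials on $[0,1]$, orthonormal in $L^2(0,1)$, $\deg P_j=j$. For $N\ge1$ put $h=(T-t_0)/N$, $t_n=t_0+nh$. A numerical solution with stepsize $h$ consists of vectors $y_0,y_1,\dots,y_N$ (with $y_0$ the given initial value) and polynomials $u_1,\dots,u_N$ of degree at most $s$ with values in $\mathbb{R}^m$ such that, for $n=1,\dots,N$, $$u_n(ch)=y_{n-1}+h\sum_{j=0}^{s-1}\int_0^cP_j(x)\,dx\;\hat\gamma_j(u_n),\qquad \hat\gamma_j(u_n)=\sum_{i=1}^k b_iP_j(c_i)f(u_n(c_ih)),\qquad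 y_n=u_n(h)$$ (these are the steps of the $k$-stage Runge–Kutta method with stages $u_n(c_ih)$; if $k\ge s$ and the $c_i$ are the zeros of $P_k$, it is the method HBVM$(k,s)$). Then: 1. There are $R$ and $h_0>0$ such that for every $N\ge 1$ with $h\le h_0$ there is a numerical solution with $|u_n(c_ih)|\le R$ for all $n=1,\dots,N$ and $i=1,\dots,k$. 2. For every $R$ there are $C$ and $h_0>0$ such that for every $N\ge1$ with $h\le h_0$ and every numerical solution with $|u_n(c_ih)|\le R$ for all $n=1,\dots,N$ and $i=1,\dots,k$, one has $$|y(t_1)-y_1|\le C h^{2s+1}$$ and, for all $n=1,\dots,N$, $$\bigl|(y(t_n)-y_n)-(y(t_{n-1})-y_{n-1})\bigr|\le C h^{2s+1},\qquad \max_{c\in[0,1]}|y(t_{n-1}+ch)-u_n(ch)|\le C h^{s+1}.$$ In other words, $y(t_n)-y_n=y(t_{n-1})-y_{n-1}+O(h^{2s+1})$ and the uniform error on each step is $O(h^{s+1})$, uniformly in $n$, as $h\to0$. -/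

import Mathlib

open scoped Polynomial

/-- The Legendre polynomials `P_j`, shifted to `[0, 1]` and normalized in `L²(0, 1)`.  The factor
`(-1) ^ j` makes the leading coefficient positive. -/
noncomputable def legendreP (j : ℕ) : ℝ[X] :=
  Polynomial.C ((-1) ^ j * Real.sqrt (2 * j + 1)) *
    (Polynomial.shiftedLegendre j).map (Int.castRingHom ℝ)

theorem natDegree_legendreP (j : ℕ) : (legendreP j).natDegree = j := by
  have h : ((-1 : ℝ) ^ j * Real.sqrt (2 * j + 1)) ≠ 0 := by positivity
  rw [legendreP, Polynomial.natDegree_C_mul h,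
    Polynomial.natDegree_map_eq_of_injective (RingHom.injective_int _),
    Polynomial.natDegree_shiftedLegendre]

theorem integral_by_parts_poly (p q : ℝ[X]) (h0 : q.eval 0 = 0) (h1 : q.eval 1 = 0) :
    ∫ x in (0 : ℝ)..1, p.eval x * q.derivative.eval x =
      -∫ x in (0 : ℝ)..1, p.derivative.eval x * q.eval x := by
  have := intervalIntegral.integral_mul_deriv_eq_deriv_mul (a := 0) (b := 1)
    (u := fun x => p.eval x) (v := fun x => q.eval x)
    (fun x _ => p.hasDerivAt x) (fun x _ => q.hasDerivAt x)
    (p.derivative.continuous.intervalIntegrable _ _)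
    (q.derivative.continuous.intervalIntegrable _ _)
  simpa [h0, h1] using this

theorem integral_iterate_parts (p : ℝ[X]) (n r : ℕ) (hr : r ≤ n) :
    ∫ x in (0 : ℝ)..1, p.eval x *
        (Polynomial.derivative^[n] (Polynomial.X ^ n * (1 - Polynomial.X) ^ n : ℝ[X])).eval x =
      (-1) ^ r * ∫ x in (0 : ℝ)..1, (Polynomial.derivative^[r] p).eval x *
        (Polynomial.derivative^[n - r]
          (Polynomial.X ^ n * (1 - Polynomial.X) ^ n : ℝ[X])).eval x := by
  induction r with
  | zero => simp
  | succ r ih =>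
    have key : ∀ a : ℝ, (a = 0 ∨ a = 1) → (Polynomial.derivative^[n - (r + 1)]
          (Polynomial.X ^ n * (1 - Polynomial.X) ^ n : ℝ[X])).eval a = 0 := by
      intro a ha
      have hd : (Polynomial.X * (1 - Polynomial.X) : ℝ[X]) ∣ Polynomial.derivative^[n - (r + 1)]
          (Polynomial.X ^ n * (1 - Polynomial.X) ^ n : ℝ[X]) := by
        rw [← mul_pow]
        refine dvd_trans (dvd_pow_self _ ?_)
          (Polynomial.pow_sub_dvd_iterate_derivative_pow _ n (n - (r + 1)))
        omega
      obtain ⟨g, hg⟩ := hd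
      rw [hg]
      rcases ha with rfl | rfl <;> simp
    rw [ih (by omega), show n - r = (n - (r + 1)) + 1 by omega, Function.iterate_succ_apply',
      integral_by_parts_poly _ _ (key 0 (Or.inl rfl)) (key 1 (Or.inr rfl)),
      Function.iterate_succ_apply', pow_succ]
    ring

theorem integral_pow_mul_one_sub_pow (b : ℕ) : ∀ a : ℕ,
    ∫ x in (0 : ℝ)..1, x ^ a * (1 - x) ^ b =
      (a.factorial * b.factorial : ℝ) / (a + b + 1).factorial := by
  induction b with
  | zero =>
    intro a
    have : (a.factorial : ℝ) ≠ 0 := by positivity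
    simp [integral_pow, Nat.factorial_succ]
    field_simp
  | succ b ih =>
    intro a
    have h := intervalIntegral.integral_mul_deriv_eq_deriv_mul (a := 0) (b := 1)
      (u := fun x : ℝ => (1 - x) ^ (b + 1)) (v := fun x : ℝ => x ^ (a + 1))
      (u' := fun x : ℝ => (((b + 1 : ℕ) : ℝ) * (1 - x) ^ b * (-1)))
      (v' := fun x : ℝ => ((a + 1 : ℕ) : ℝ) * x ^ a)
      (fun x _ => ((hasDerivAt_id' x).const_sub 1).fun_pow (b + 1))
      (fun x _ => by simpa using (hasDerivAt_pow (a + 1) x))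
      (Continuous.intervalIntegrable (by fun_prop) _ _)
      (Continuous.intervalIntegrable (by fun_prop) _ _)
    have h1 : ∫ x in (0 : ℝ)..1, (1 - x) ^ (b + 1) * (((a + 1 : ℕ) : ℝ) * x ^ a) =
        (a + 1) * ∫ x in (0 : ℝ)..1, x ^ a * (1 - x) ^ (b + 1) := by
      rw [← intervalIntegral.integral_const_mul]
      congr 1; ext x; push_cast; ring
    have h2 : ∫ x in (0 : ℝ)..1, ((b + 1 : ℕ) : ℝ) * (1 - x) ^ b * (-1) * x ^ (a + 1) =
        -((b + 1) * ∫ x in (0 : ℝ)..1, x ^ (a + 1) * (1 - x) ^ b) := by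
      rw [← intervalIntegral.integral_const_mul, ← intervalIntegral.integral_neg]
      congr 1; ext x; push_cast; ring
    rw [h1, h2, ih (a + 1)] at h
    have ha : ((a : ℝ) + 1) ≠ 0 := by positivity
    rw [show a + (b + 1) + 1 = a + 1 + b + 1 by ring]
    apply mul_left_cancel₀ ha
    rw [h]
    simp [Nat.factorial_succ a, Nat.factorial_succ b]
    ring

theorem factorial_mul_map_shiftedLegendre (n : ℕ) :
    Polynomial.C (n.factorial : ℝ) * (Polynomial.shiftedLegendre n).map (Int.castRingHom ℝ) =
      Polynomial.derivative^[n] (Polynomial.X ^ n * (1 - Polynomial.X) ^ n : ℝ[X]) := by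
  have h := congrArg (Polynomial.map (Int.castRingHom ℝ))
    (Polynomial.factorial_mul_shiftedLegendre_eq n)
  rw [← Polynomial.iterate_derivative_map] at h
  simpa using h

theorem integral_mul_shiftedLegendre (p : ℝ[X]) (n : ℕ) :
    (n.factorial : ℝ) * ∫ x in (0 : ℝ)..1,
        p.eval x * ((Polynomial.shiftedLegendre n).map (Int.castRingHom ℝ)).eval x =
      (-1) ^ n * ∫ x in (0 : ℝ)..1,
        (Polynomial.derivative^[n] p).eval x * (x ^ n * (1 - x) ^ n) := by
  have h := integral_iterate_parts p n n le_rfl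
  rw [← factorial_mul_map_shiftedLegendre] at h
  simp only [Nat.sub_self, Function.iterate_zero, id, Polynomial.eval_mul, Polynomial.eval_C,
    Polynomial.eval_pow, Polynomial.eval_X, Polynomial.eval_sub, Polynomial.eval_one] at h
  rw [← h, ← intervalIntegral.integral_const_mul]
  congr 1; ext x; ring

theorem integral_shiftedLegendre_of_lt (m n : ℕ) (h : m < n) :
    ∫ x in (0 : ℝ)..1, ((Polynomial.shiftedLegendre m).map (Int.castRingHom ℝ)).eval x *
        ((Polynomial.shiftedLegendre n).map (Int.castRingHom ℝ)).eval x = 0 := by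
  have h1 := integral_mul_shiftedLegendre
    ((Polynomial.shiftedLegendre m).map (Int.castRingHom ℝ)) n
  rw [Polynomial.iterate_derivative_eq_zero (lt_of_le_of_lt Polynomial.natDegree_map_le
    (by simpa using h))] at h1
  have hn : (n.factorial : ℝ) ≠ 0 := by positivity
  simpa [hn] using h1

theorem integral_shiftedLegendre_sq (n : ℕ) :
    ∫ x in (0 : ℝ)..1, ((Polynomial.shiftedLegendre n).map (Int.castRingHom ℝ)).eval x *
        ((Polynomial.shiftedLegendre n).map (Int.castRingHom ℝ)).eval x = 1 / (2 * n + 1) := by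
  have h1 := integral_mul_shiftedLegendre
    ((Polynomial.shiftedLegendre n).map (Int.castRingHom ℝ)) n
  have hd : Polynomial.derivative^[n] ((Polynomial.shiftedLegendre n).map (Int.castRingHom ℝ)) =
      Polynomial.C ((n.factorial : ℝ) * ((-1) ^ n * (n + n).choose n)) := by
    have h2 : (Polynomial.derivative^[n]
        ((Polynomial.shiftedLegendre n).map (Int.castRingHom ℝ))).natDegree = 0 := by
      have := Polynomial.natDegree_iterate_derivative
        ((Polynomial.shiftedLegendre n).map (Int.castRingHom ℝ)) n
      have h3 : ((Polynomial.shiftedLegendre n).map (Int.castRingHom ℝ)).natDegree ≤ n :=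
        Polynomial.natDegree_map_le.trans (by simp)
      omega
    rw [Polynomial.eq_C_of_natDegree_eq_zero h2, Polynomial.coeff_iterate_derivative]
    simp [Polynomial.coeff_shiftedLegendre, Nat.descFactorial_self]
  rw [hd] at h1
  simp only [Polynomial.eval_C, intervalIntegral.integral_const_mul,
    integral_pow_mul_one_sub_pow] at h1
  have hn : (n.factorial : ℝ) ≠ 0 := by positivity
  apply mul_left_cancel₀ hn
  rw [h1]
  have hc : ((n + n).choose n : ℝ) * (n.factorial * n.factorial) = (n + n).factorial := by
    have := Nat.add_choose_mul_factorial_mul_factorial n n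
    rw [← mul_assoc]; exact_mod_cast this
  have hs : ((-1 : ℝ) ^ n) * (-1) ^ n = 1 := by rw [← mul_pow]; simp
  have hf : ((n + n + 1).factorial : ℝ) = (2 * n + 1) * (n + n).factorial := by
    rw [Nat.factorial_succ]; push_cast; ring
  have h2 : ((n + n).factorial : ℝ) ≠ 0 := by positivity
  have h3 : (2 * (n : ℝ) + 1) ≠ 0 := by positivity
  rw [hf]
  field_simp
  linear_combination (((n + n).choose n : ℝ) * (n.factorial * n.factorial)) * hs + hc

/-- The `P_j` are orthonormal: `∫₀¹ P_i P_j = δ_ij`. -/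
theorem legendreP_orthonormal (i j : ℕ) :
    ∫ x in (0 : ℝ)..1, (legendreP i).eval x * (legendreP j).eval x = if i = j then 1 else 0 := by
  have h : ∫ x in (0 : ℝ)..1, (legendreP i).eval x * (legendreP j).eval x =
      ((-1) ^ i * Real.sqrt (2 * i + 1)) * ((-1) ^ j * Real.sqrt (2 * j + 1)) *
      ∫ x in (0 : ℝ)..1, ((Polynomial.shiftedLegendre i).map (Int.castRingHom ℝ)).eval x *
        ((Polynomial.shiftedLegendre j).map (Int.castRingHom ℝ)).eval x := by
    rw [← intervalIntegral.integral_const_mul]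
    congr 1; ext x
    simp only [legendreP, Polynomial.eval_mul, Polynomial.eval_C]
    ring
  rw [h]
  rcases lt_trichotomy i j with hij | rfl | hij
  · rw [integral_shiftedLegendre_of_lt i j hij, if_neg hij.ne, mul_zero]
  · rw [integral_shiftedLegendre_sq, if_pos rfl]
    have hs : ((-1 : ℝ) ^ i) * (-1) ^ i = 1 := by rw [← mul_pow]; simp
    have h3 : (2 * (i : ℝ) + 1) ≠ 0 := by positivity
    have hq : Real.sqrt (2 * i + 1) * Real.sqrt (2 * i + 1) = 2 * i + 1 :=
      Real.mul_self_sqrt (by positivity)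
    rw [show ((-1 : ℝ) ^ i * Real.sqrt (2 * i + 1)) * ((-1) ^ i * Real.sqrt (2 * i + 1)) =
      ((-1) ^ i * (-1) ^ i) * (Real.sqrt (2 * i + 1) * Real.sqrt (2 * i + 1)) by ring, hs, hq]
    field_simp
  · rw [if_neg hij.ne']
    have := integral_shiftedLegendre_of_lt j i hij
    simp_rw [mul_comm] at this ⊢
    simp [this]

/-- `(c_i, b_i)`, `i = 1, …, k`, is an interpolatory quadrature on `[0, 1]`: the abscissae are
distinct and `b_i` is the integral of the `i`-th Lagrange basis polynomial at the abscissae. -/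
def IsInterpolatoryQuadrature {k : ℕ} (c b : Fin k → ℝ) : Prop :=
  Function.Injective c ∧
    ∀ i, b i = ∫ x in (0 : ℝ)..1, (Lagrange.basis Finset.univ c i).eval x

/-- The quadrature `(c_i, b_i)` has order `q`: it is exact for polynomials of degree at most
`q - 1`. -/
def QuadratureHasOrder {k : ℕ} (c b : Fin k → ℝ) (q : ℕ) : Prop :=
  ∀ p : ℝ[X], p.natDegree < q → ∑ i, b i * p.eval (c i) = ∫ x in (0 : ℝ)..1, p.eval x

/-- The approximate Fourier coefficient `γ̂_j(z) = ∑ i, b_i P_j(c_i) f(z(c_i h))`. -/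
noncomputable def gammaHat {m k : ℕ}
    (f : EuclideanSpace ℝ (Fin m) → EuclideanSpace ℝ (Fin m)) (c b : Fin k → ℝ) (h : ℝ)
    (z : ℝ → EuclideanSpace ℝ (Fin m)) (j : ℕ) : EuclideanSpace ℝ (Fin m) :=
  ∑ i, (b i * (legendreP j).eval (c i)) • f (z (c i * h))

/-- `u n` and `Y n` (for `n = 1, …, N`, with `Y 0 = y₀`) are the local polynomials and the grid
values produced by `N` steps of size `h`:
`u_n(x h) = y_{n-1} + h ∑_{j < s} (∫₀ˣ P_j) γ̂_j(u_n)` and `y_n = u_n(h)`.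
The identity is imposed for every real `x`: `u_n` is a polynomial of degree at most `s`, so that
`u_n(c_i h)` makes sense for abscissae outside `[0, 1]` too. -/
structure IsNumericalSolution {m k : ℕ}
    (f : EuclideanSpace ℝ (Fin m) → EuclideanSpace ℝ (Fin m)) (c b : Fin k → ℝ) (s : ℕ)
    (y₀ : EuclideanSpace ℝ (Fin m)) (h : ℝ) (N : ℕ)
    (u : ℕ → ℝ → EuclideanSpace ℝ (Fin m)) (Y : ℕ → EuclideanSpace ℝ (Fin m)) : Prop where
  initial : Y 0 = y₀
  local_eq : ∀ n, n < N → ∀ x : ℝ, u (n + 1) (x * h) =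
    Y n + h • ∑ j ∈ Finset.range s,
      (∫ τ in (0 : ℝ)..x, (legendreP j).eval τ) • gammaHat f c b h (u (n + 1)) j
  grid_eq : ∀ n, n < N → Y (n + 1) = u (n + 1) h

/-! ### Polynomial curves and the Legendre projection -/

/-! On one step put `w(x) = u(xh)`. Then `w' = h Π(f ∘ w)`, where `Π` (`legendreProj`) is the
Legendre projection of degree below `s` with its integrals replaced by the quadrature. Order `q ≥
2s` makes `Π` reproduce polynomial curves of degree below `s`. Subtracting Taylor polynomials, one
finds inductively that the `i`-th derivative of `w` is `O(h^i)`
(`exists_norm_iteratedDeriv_step_le`), so `F = f ∘ w` is within `O(h^r)` of polynomials of degree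
below `r` for every `r ≤ 2s`.

The defect `d = h (ΠF - F)` is therefore `O(h^(s+1))` pointwise. For a polynomial `p` of degree `n <
s`, `∫ p ΠF` equals the quadrature of `pF`, so `∫ p d` is `h` times a quadrature error and is
`O(h^(2s-n+1))`. If the derivatives of `G` satisfy `G^(i) = O(h^i)`, expanding `G` gives `∫ G d =
O(h^(2s+1))`: the Taylor coefficients supply the missing factors `h^n`, and the remainder pairs
`h^s` with `h^(s+1)` (`exists_norm_integral_clm_stepDefect_le`).

The error `e = z - w` against the scaled solution `z` satisfies `e' = h A e - d + O(h |e|^2)` with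
`A = f'(w)`. Let `G` nearly solve the adjoint equation `G' = -h G A`, `G(1) = 1`; Picard iteration
produces such a `G` with residual `O(h^(s+1))` and derivatives of the required size
(`exists_approx_resolvent`). Integrating the derivative of `G e + ∫ G d` gives `e(1) - e(0) = O(h
|e(0)| + h^(2s+1))` (`exists_norm_error_increment_le`).

A discrete Gronwall argument then bounds the global error by `O(h^(2s))`; reinserted into the
increment estimate, this gives `O(h^(2s+1))`. The same bound keeps the grid values near the
trajectory, so the fixed point argument of `exists_isStep` applies at every step. -/

theorem exists_eq_sum_legendreP (s : ℕ) : ∀ p : ℝ[X], p.degree < s →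
    ∃ a : ℕ → ℝ, p = ∑ j ∈ Finset.range s, Polynomial.C (a j) * legendreP j := by
  induction s with
  | zero =>
    intro p hp
    refine ⟨0, ?_⟩
    simpa using hp
  | succ s ih =>
    intro p hp
    have hlead : (legendreP s).coeff s ≠ 0 := by
      have h0 : legendreP s ≠ 0 := by
        intro h
        have := legendreP_orthonormal s s
        simp [h] at this
      have := Polynomial.leadingCoeff_ne_zero.mpr h0
      rwa [Polynomial.leadingCoeff, natDegree_legendreP] at this
    have hq : (p - Polynomial.C (p.coeff s / (legendreP s).coeff s) * legendreP s).degree < s := by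
      rw [Polynomial.degree_lt_iff_coeff_zero] at hp ⊢
      intro n hn
      rw [Polynomial.coeff_sub, Polynomial.coeff_C_mul]
      rcases hn.eq_or_lt with rfl | hn
      · field_simp
        ring
      · rw [hp n hn, Polynomial.coeff_eq_zero_of_natDegree_lt (p := legendreP s) (n := n)
          (by rwa [natDegree_legendreP])]
        simp
    obtain ⟨a, ha⟩ := ih _ hq
    refine ⟨Function.update a s (p.coeff s / (legendreP s).coeff s), ?_⟩
    rw [Finset.sum_range_succ, Function.update_self]
    rw [sub_eq_iff_eq_add] at ha
    conv_lhs => rw [ha]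
    congr 1
    refine Finset.sum_congr rfl fun j hj => ?_
    rw [Function.update_of_ne (Finset.mem_range.mp hj).ne]

/-- By orthonormality, `∑ P_j(x) P_j(τ)` is a reproducing kernel on polynomials of degree below `s`.
-/
theorem sum_legendreP_mul_integral (s : ℕ) (p : ℝ[X]) (hp : p.degree < s) (x : ℝ) :
    ∑ j ∈ Finset.range s, (legendreP j).eval x *
      ∫ τ in (0 : ℝ)..1, (legendreP j * p).eval τ = p.eval x := by
  obtain ⟨a, ha⟩ := exists_eq_sum_legendreP s p hp
  have hint : ∀ j ∈ Finset.range s, ∫ τ in (0 : ℝ)..1, (legendreP j * p).eval τ = a j := by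
    intro j hj
    have h1 : ∀ τ, (legendreP j * p).eval τ =
        ∑ i ∈ Finset.range s, a i * ((legendreP j).eval τ * (legendreP i).eval τ) := by
      intro τ
      rw [ha, Polynomial.eval_mul, Polynomial.eval_finsetSum, Finset.mul_sum]
      refine Finset.sum_congr rfl fun i _ => ?_
      rw [Polynomial.eval_mul, Polynomial.eval_C]
      ring
    simp_rw [h1]
    rw [intervalIntegral.integral_finsetSum
      fun i _ => Continuous.intervalIntegrable (by fun_prop) _ _]
    simp_rw [intervalIntegral.integral_const_mul, legendreP_orthonormal]
    simpa using fun h : s ≤ j => absurd (Finset.mem_range.mp hj) h.not_gt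
  rw [Finset.sum_congr rfl fun j hj => by rw [hint j hj], ha, Polynomial.eval_finsetSum]
  refine Finset.sum_congr rfl fun i _ => ?_
  rw [Polynomial.eval_mul, Polynomial.eval_C]
  ring

/-- The curve `x ↦ ∑ j < n, p_j(x) a_j`. -/
noncomputable def polyCurve {E : Type*} [AddCommGroup E] [Module ℝ E]
    (n : ℕ) (p : ℕ → ℝ[X]) (a : ℕ → E) (x : ℝ) : E :=
  ∑ j ∈ Finset.range n, (p j).eval x • a j

/-- The discrete Legendre projection
`F ↦ ∑ j < s, P_j(x) ∑ i, b_i P_j(c_i) F(c_i)`. -/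
noncomputable def legendreProj {E : Type*} [AddCommGroup E] [Module ℝ E] {k : ℕ}
    (c b : Fin k → ℝ) (s : ℕ) (F : ℝ → E) : ℝ → E :=
  polyCurve s legendreP fun j => ∑ i, (b i * (legendreP j).eval (c i)) • F (c i)

section polyCurve

variable {E : Type*} [NormedAddCommGroup E] [NormedSpace ℝ E]

theorem contDiff_polyCurve {N : WithTop ℕ∞} (n : ℕ) (p : ℕ → ℝ[X]) (a : ℕ → E) :
    ContDiff ℝ N (polyCurve n p a) := by
  unfold polyCurve
  refine ContDiff.sum fun j _ => ContDiff.smul ?_ contDiff_const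
  exact (p j).contDiff_aeval (𝕜 := ℝ) N

theorem continuous_polyCurve (n : ℕ) (p : ℕ → ℝ[X]) (a : ℕ → E) :
    Continuous (polyCurve n p a) :=
  (contDiff_polyCurve (N := 0) n p a).continuous

theorem deriv_polyCurve (n : ℕ) (p : ℕ → ℝ[X]) (a : ℕ → E) :
    deriv (polyCurve n p a) = polyCurve n (fun j => (p j).derivative) a := by
  ext x
  refine HasDerivAt.deriv ?_
  unfold polyCurve
  exact HasDerivAt.fun_sum fun j _ => ((p j).hasDerivAt x).smul_const (a j)

theorem iteratedDeriv_polyCurve (r n : ℕ) (p : ℕ → ℝ[X]) (a : ℕ → E) :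
    iteratedDeriv r (polyCurve n p a) =
      polyCurve n (fun j => Polynomial.derivative^[r] (p j)) a := by
  induction r with
  | zero => simp
  | succ r ih =>
    rw [iteratedDeriv_succ, ih, deriv_polyCurve]
    simp_rw [Function.iterate_succ_apply']

theorem iteratedDeriv_polyCurve_eq_zero (r n : ℕ) (p : ℕ → ℝ[X]) (a : ℕ → E)
    (hp : ∀ j < n, (p j).natDegree < r) : iteratedDeriv r (polyCurve n p a) = 0 := by
  rw [iteratedDeriv_polyCurve]
  ext x
  refine Finset.sum_eq_zero fun j hj => ?_
  simp [Polynomial.iterate_derivative_eq_zero (hp j (Finset.mem_range.mp hj))]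

theorem exists_abs_eval_le (p : ℝ[X]) (L : ℝ) :
    ∃ M, 0 ≤ M ∧ ∀ x ∈ Set.Icc (-L) L, |p.eval x| ≤ M := by
  obtain ⟨M, hM⟩ := (isCompact_Icc (a := -L) (b := L)).exists_bound_of_continuousOn
    p.continuous.continuousOn
  exact ⟨max M 0, le_max_right _ _, fun x hx => (hM x hx).trans (le_max_left _ _)⟩

theorem exists_norm_polyCurve_le (n : ℕ) (p : ℕ → ℝ[X]) (L : ℝ) :
    ∃ M, 0 ≤ M ∧ ∀ (a : ℕ → E) (δ : ℝ), (∀ j < n, ‖a j‖ ≤ δ) →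
      ∀ x ∈ Set.Icc (-L) L, ‖polyCurve n p a x‖ ≤ M * δ := by
  choose M hM0 hM using fun j => exists_abs_eval_le (p j) L
  refine ⟨∑ j ∈ Finset.range n, M j, Finset.sum_nonneg fun j _ => hM0 j, fun a δ ha x hx => ?_⟩
  rw [Finset.sum_mul]
  refine (norm_sum_le _ _).trans (Finset.sum_le_sum fun j hj => ?_)
  rw [norm_smul]
  exact mul_le_mul (hM j x hx) (ha j (Finset.mem_range.mp hj)) (norm_nonneg _) (hM0 j)

variable {k : ℕ}

theorem legendreProj_sub (c b : Fin k → ℝ) (s : ℕ) (F G : ℝ → E) (x : ℝ) :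
    legendreProj c b s (fun t => F t - G t) x =
      legendreProj c b s F x - legendreProj c b s G x := by
  simp only [legendreProj, polyCurve, smul_sub, Finset.sum_sub_distrib]

theorem exists_norm_sum_smul_le (v : Fin k → ℝ) :
    ∃ M, 0 ≤ M ∧ ∀ (a : Fin k → E) (δ : ℝ), (∀ i, ‖a i‖ ≤ δ) → ‖∑ i, v i • a i‖ ≤ M * δ := by
  refine ⟨∑ i, |v i|, Finset.sum_nonneg fun j _ => abs_nonneg _, fun a δ ha => ?_⟩
  rw [Finset.sum_mul]
  refine (norm_sum_le _ _).trans (Finset.sum_le_sum fun j hj => ?_)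
  rw [norm_smul]
  exact mul_le_mul_of_nonneg_left (ha j) (abs_nonneg _)

theorem exists_norm_iteratedDeriv_legendreProj_le (c b : Fin k → ℝ) (s r : ℕ) (L : ℝ) :
    ∃ M, 0 ≤ M ∧ ∀ (F : ℝ → E) (δ : ℝ), (∀ i, ‖F (c i)‖ ≤ δ) →
      ∀ x ∈ Set.Icc (-L) L, ‖iteratedDeriv r (legendreProj c b s F) x‖ ≤ M * δ := by
  choose B hB0 hB using fun j => exists_norm_sum_smul_le (E := E)
    fun i => b i * (legendreP j).eval (c i)
  obtain ⟨M, hM0, hM⟩ := exists_norm_polyCurve_le (E := E) s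
    (fun j => Polynomial.derivative^[r] (legendreP j)) L
  have hBs : ∀ j < s, B j ≤ ∑ j ∈ Finset.range s, B j := fun j hj =>
    Finset.single_le_sum (f := B) (fun j _ => hB0 j) (Finset.mem_range.mpr hj)
  -- Without nodes nothing forces `δ ≥ 0`, but the projection vanishes and `M = 0` serves.
  rcases isEmpty_or_nonempty (Fin k) with hk | ⟨⟨i₀⟩⟩
  · refine ⟨0, le_rfl, fun F δ _ x _ => ?_⟩
    have : legendreProj c b s F = polyCurve s legendreP 0 := by
      unfold legendreProj; congr 1; ext j; simp
    rw [this, iteratedDeriv_polyCurve]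
    simp [polyCurve]
  refine ⟨M * ∑ j ∈ Finset.range s, B j, mul_nonneg hM0 (Finset.sum_nonneg fun j _ => hB0 j),
    fun F δ hF x hx => ?_⟩
  have hδ : 0 ≤ δ := (norm_nonneg _).trans (hF i₀)
  unfold legendreProj
  rw [iteratedDeriv_polyCurve, mul_assoc]
  refine hM _ _ (fun j hj => (hB j _ δ fun i => hF i).trans ?_) x hx
  exact mul_le_mul_of_nonneg_right (hBs j hj) hδ

theorem contDiff_legendreProj {N : WithTop ℕ∞} (c b : Fin k → ℝ) (s : ℕ) (F : ℝ → E) :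
    ContDiff ℝ N (legendreProj c b s F) :=
  contDiff_polyCurve _ _ _

variable {c b : Fin k → ℝ} {q s : ℕ}

/-- The discrete Legendre projection reproduces polynomial curves of degree less than `s`. -/
theorem legendreProj_polyCurve (hord : QuadratureHasOrder c b q) (hq : 2 * s ≤ q) (n : ℕ)
    (p : ℕ → ℝ[X]) (hp : ∀ i < n, (p i).natDegree < s) (a : ℕ → E) :
    legendreProj c b s (polyCurve n p a) = polyCurve n p a := by
  ext x
  have h1 : ∀ i ∈ Finset.range n, (∑ j ∈ Finset.range s, (legendreP j).eval x *
      ∑ l, b l * (legendreP j).eval (c l) * (p i).eval (c l)) = (p i).eval x := by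
    intro i hi
    have hpi := hp i (Finset.mem_range.mp hi)
    rw [← sum_legendreP_mul_integral s (p i)
      (Polynomial.degree_le_natDegree.trans_lt (by exact_mod_cast hpi)) x]
    refine Finset.sum_congr rfl fun j hj => ?_
    rw [← hord]
    · simp [Polynomial.eval_mul, mul_assoc]
    -- `P_j p_i` has degree at most `2s - 2`, so the quadrature integrates it exactly.
    · refine Polynomial.natDegree_mul_le.trans_lt ?_
      rw [natDegree_legendreP]
      have := Finset.mem_range.mp hj
      omega
  calc legendreProj c b s (polyCurve n p a) x
      = ∑ i ∈ Finset.range n, (∑ j ∈ Finset.range s, (legendreP j).eval x *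
          ∑ l, b l * (legendreP j).eval (c l) * (p i).eval (c l)) • a i := by
        simp only [legendreProj, polyCurve, Finset.smul_sum, Finset.sum_smul, Finset.mul_sum,
          smul_smul]
        rw [Finset.sum_congr rfl fun j _ => Finset.sum_comm, Finset.sum_comm]
    _ = polyCurve n p a x := Finset.sum_congr rfl fun i hi => by rw [h1 i hi]

/-- The integrals of `P_j p` are the Legendre coefficients of `p`, which resum to `p` at each node.
No exactness of the quadrature enters. This turns moments of the defect into quadrature errors. -/
theorem integral_eval_smul_legendreProj [CompleteSpace E]
    (p : ℝ[X]) (hp : p.natDegree < s) (F : ℝ → E) :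
    ∫ x in (0 : ℝ)..1, p.eval x • legendreProj c b s F x =
      ∑ l, (b l * p.eval (c l)) • F (c l) := by
  have h1 : ∀ x, p.eval x • legendreProj c b s F x = ∑ j ∈ Finset.range s,
      (legendreP j * p).eval x • ∑ i, (b i * (legendreP j).eval (c i)) • F (c i) := by
    intro x
    rw [legendreProj, polyCurve, Finset.smul_sum]
    refine Finset.sum_congr rfl fun j _ => ?_
    rw [smul_smul, Polynomial.eval_mul, mul_comm]
  simp_rw [h1]
  rw [intervalIntegral.integral_finsetSum
    fun i _ => Continuous.intervalIntegrable (by fun_prop) _ _]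
  simp_rw [intervalIntegral.integral_smul_const, Finset.smul_sum]
  rw [Finset.sum_comm]
  refine Finset.sum_congr rfl fun l _ => ?_
  rw [← sum_legendreP_mul_integral s p
    (Polynomial.degree_le_natDegree.trans_lt (by exact_mod_cast hp)) (c l),
    Finset.mul_sum, Finset.sum_smul]
  refine Finset.sum_congr rfl fun j _ => ?_
  rw [smul_smul]
  ring_nf

/-- The error of the quadrature for a function `p F`, in terms of the distance of `F` from the
polynomial curves of degree less than `r`. -/
theorem exists_norm_quadrature_sub_integral_le [CompleteSpace E] (hord : QuadratureHasOrder c b q)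
    {L : ℝ} (hL : 1 ≤ L) (hc : ∀ i, |c i| ≤ L) (p : ℝ[X]) (r : ℕ)
    (hdeg : p.natDegree + r ≤ q) :
    ∃ M, 0 ≤ M ∧ ∀ (F : ℝ → E) (a : ℕ → E) (ε : ℝ), Continuous F →
      (∀ x ∈ Set.Icc (-L) L,
        ‖F x - polyCurve r (fun i => (Polynomial.X + Polynomial.C L) ^ i) a x‖ ≤ ε) →
      ‖(∑ l, (b l * p.eval (c l)) • F (c l)) - ∫ x in (0 : ℝ)..1, p.eval x • F x‖ ≤ M * ε := by
  obtain ⟨M₁, hM₁0, hM₁⟩ := exists_norm_sum_smul_le (E := E) fun l => b l * p.eval (c l)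
  obtain ⟨M₂, hM₂0, hM₂⟩ := exists_abs_eval_le p L
  refine ⟨M₁ + M₂, by positivity, fun F a ε hF hFa => ?_⟩
  set P := polyCurve r (fun i => (Polynomial.X + Polynomial.C L) ^ i) a with hP
  have hPc : Continuous P := continuous_polyCurve _ _ _
  have hexact : ∑ l, (b l * p.eval (c l)) • P (c l) = ∫ x in (0 : ℝ)..1, p.eval x • P x := by
    have h1 : ∀ x, p.eval x • P x =
        ∑ i ∈ Finset.range r, (p * (Polynomial.X + Polynomial.C L) ^ i).eval x • a i := by
      intro x
      rw [hP, polyCurve, Finset.smul_sum]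
      refine Finset.sum_congr rfl fun i _ => ?_
      rw [smul_smul, ← Polynomial.eval_mul]
    simp_rw [mul_smul, h1]
    rw [intervalIntegral.integral_finsetSum
      fun i _ => Continuous.intervalIntegrable (by fun_prop) _ _]
    simp_rw [intervalIntegral.integral_smul_const, Finset.smul_sum]
    rw [Finset.sum_comm]
    refine Finset.sum_congr rfl fun i hi => ?_
    rw [← hord, Finset.sum_smul]
    · simp_rw [smul_smul]
    · refine Polynomial.natDegree_mul_le.trans_lt ?_
      have h2 : ((Polynomial.X + Polynomial.C L) ^ i).natDegree ≤ i := by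
        refine Polynomial.natDegree_pow_le.trans ?_
        rw [Polynomial.natDegree_X_add_C, mul_one]
      have := Finset.mem_range.mp hi
      omega
  have hsplit : (∑ l, (b l * p.eval (c l)) • F (c l)) - ∫ x in (0 : ℝ)..1, p.eval x • F x =
      (∑ l, (b l * p.eval (c l)) • (F (c l) - P (c l))) -
        ∫ x in (0 : ℝ)..1, p.eval x • (F x - P x) := by
    simp_rw [smul_sub]
    rw [Finset.sum_sub_distrib, intervalIntegral.integral_sub
      (Continuous.intervalIntegrable (by fun_prop) _ _)
      (Continuous.intervalIntegrable (by fun_prop) _ _), hexact]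
    abel
  rw [hsplit, add_mul]
  refine (norm_sub_le _ _).trans (add_le_add ?_ ?_)
  · exact hM₁ _ _ fun l => hFa _ (abs_le.mp (hc l))
  · have := intervalIntegral.norm_integral_le_of_norm_le_const (a := 0) (b := 1)
      (f := fun x => p.eval x • (F x - P x)) (C := M₂ * ε) ?_
    · simpa using this
    intro x hx
    rw [Set.uIoc_of_le zero_le_one] at hx
    have hxL : x ∈ Set.Icc (-L) L := ⟨by linarith [hx.1], hx.2.trans hL⟩
    rw [norm_smul]
    exact mul_le_mul (hM₂ x hxL) (hFa x hxL) (norm_nonneg _) hM₂0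

end polyCurve

/-! ### Taylor expansions with uniform bounds -/

theorem exists_norm_le_of_continuous {E V : Type*} [NormedAddCommGroup E]
    [NormedAddCommGroup V] [ProperSpace E] {g : E → V} (hg : Continuous g) (ρ : ℝ) :
    ∃ M, 0 ≤ M ∧ ∀ x, ‖x‖ ≤ ρ → ‖g x‖ ≤ M := by
  obtain ⟨M, hM⟩ := (isCompact_closedBall (0 : E) ρ).exists_bound_of_continuousOn hg.continuousOn
  exact ⟨max M 0, le_max_right _ _, fun x hx =>
    (hM x (by simpa using hx)).trans (le_max_left _ _)⟩

section Taylor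

variable {E V : Type*} [NormedAddCommGroup E] [NormedSpace ℝ E]
  [NormedAddCommGroup V] [NormedSpace ℝ V]

/-- The expansion is at the left endpoint of an interval containing `[0, 1]` and all nodes, hence
the powers of `X + L` and the length factor `2L`; the factorial in the remainder is dropped. -/
theorem norm_sub_taylor_le {L : ℝ} (hL : 1 ≤ L) (r : ℕ) {g : ℝ → E} (hg : ContDiff ℝ r g) {M : ℝ}
    (hM : ∀ x ∈ Set.Icc (-L) L, ‖iteratedDeriv r g x‖ ≤ M) {x : ℝ} (hx : x ∈ Set.Icc (-L) L) :
    ‖g x - polyCurve r (fun i => (Polynomial.X + Polynomial.C L) ^ i)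
      (fun i => ((i.factorial : ℝ)⁻¹) • iteratedDeriv i g (-L)) x‖ ≤ (2 * L) ^ r * M := by
  have hLL : -L < L := by linarith
  have hM0 : 0 ≤ M := (norm_nonneg _).trans (hM x hx)
  cases r with
  | zero => simpa [polyCurve] using hM x hx
  | succ n =>
    have hu := uniqueDiffOn_Icc hLL
    have hid : ∀ i ≤ n + 1, ∀ z ∈ Set.Icc (-L) L,
        iteratedDerivWithin i g (Set.Icc (-L) L) z = iteratedDeriv i g z := fun i hi z hz =>
      iteratedDerivWithin_eq_iteratedDeriv hu
        ((hg.of_le (by exact_mod_cast hi)).contDiffAt) hz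
    have h1 := taylor_mean_remainder_bound (n := n) (C := M) hLL.le
      (by exact_mod_cast hg.contDiffOn) hx (fun z hz => by rw [hid _ le_rfl z hz]; exact hM z hz)
    rw [taylor_within_apply] at h1
    have h2 : polyCurve (n + 1) (fun i => (Polynomial.X + Polynomial.C L) ^ i)
        (fun i => ((i.factorial : ℝ)⁻¹) • iteratedDeriv i g (-L)) x =
        ∑ k ∈ Finset.range (n + 1), ((k.factorial : ℝ)⁻¹ * (x - -L) ^ k) •
          iteratedDerivWithin k g (Set.Icc (-L) L) (-L) := by
      refine Finset.sum_congr rfl fun i hi => ?_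
      rw [hid i (Finset.mem_range.mp hi).le _ (Set.left_mem_Icc.mpr hLL.le), smul_smul]
      simp [mul_comm]
    rw [h2]
    refine h1.trans ?_
    have h3 : (x - -L) ^ (n + 1) ≤ (2 * L) ^ (n + 1) :=
      pow_le_pow_left₀ (by linarith [hx.1]) (by linarith [hx.2]) _
    have h4 : (1 : ℝ) ≤ n.factorial := by exact_mod_cast Nat.one_le_iff_ne_zero.mpr n.factorial_ne_zero
    refine (div_le_self (mul_nonneg hM0 (pow_nonneg (by linarith [hx.1]) _)) h4).trans ?_
    rw [mul_comm]
    exact mul_le_mul_of_nonneg_right h3 hM0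

/-- Each term of the Faà di Bruno formula for the `i`-th derivative has total differentiation order
`i` in `w`, so the scaling `h^i` survives composition. -/
theorem exists_norm_iteratedDeriv_comp_le [ProperSpace E] (r : ℕ) {g : E → V}
    (hg : ContDiff ℝ r g) (ρ D : ℝ) :
    ∃ C, 0 ≤ C ∧ ∀ h : ℝ, 0 < h → ∀ w : ℝ → E, ContDiff ℝ r w → ∀ x, ‖w x‖ ≤ ρ →
      (∀ i, 1 ≤ i → i ≤ r → ‖iteratedDeriv i w x‖ ≤ D * h ^ i) →
      ∀ i ≤ r, ‖iteratedDeriv i (fun t => g (w t)) x‖ ≤ C * h ^ i := by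
  -- The value `0` beyond order `r` only makes the choice of `M` total.
  have hM : ∀ i : ℕ, ∃ M, 0 ≤ M ∧ (i ≤ r → ∀ x, ‖x‖ ≤ ρ → ‖iteratedFDeriv ℝ i g x‖ ≤ M) := by
    intro i
    by_cases hi : i ≤ r
    · obtain ⟨M, h0, hM⟩ := exists_norm_le_of_continuous
        (hg.continuous_iteratedFDeriv (m := i) (by exact_mod_cast hi)) ρ
      exact ⟨M, h0, fun _ => hM⟩
    · exact ⟨0, le_rfl, fun h => absurd h hi⟩
  choose M hM0 hM using hM
  set S := ∑ i ∈ Finset.range (r + 1), M i with hS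
  have hS0 : 0 ≤ S := Finset.sum_nonneg fun j _ => hM0 j
  have hMS : ∀ j ≤ r, M j ≤ S := fun j hj =>
    Finset.single_le_sum (f := M) (fun j _ => hM0 j) (Finset.mem_range.mpr (by omega))
  set D' := max 1 D
  have hD' : 1 ≤ D' := le_max_left _ _
  refine ⟨r.factorial * S * D' ^ r, by positivity, fun h hh w hw x hx hd i hi => ?_⟩
  have h1 := norm_iteratedFDeriv_comp_le hg hw (n := i) (by exact_mod_cast hi) x (C := S)
    (D := D' * h) (fun j hj => (hM j (hj.trans hi) _ hx).trans (hMS j (hj.trans hi))) ?_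
  · rw [norm_iteratedFDeriv_eq_norm_iteratedDeriv, mul_pow] at h1
    refine h1.trans ?_
    have h2 : (i.factorial : ℝ) ≤ r.factorial := by exact_mod_cast Nat.factorial_le hi
    have h3 : D' ^ i ≤ D' ^ r := pow_le_pow_right₀ hD' hi
    rw [← mul_assoc]
    gcongr
  · intro j hj1 hj
    rw [norm_iteratedFDeriv_eq_norm_iteratedDeriv, mul_pow]
    refine (hd j hj1 (hj.trans hi)).trans ?_
    gcongr
    exact (le_max_right 1 D).trans (le_self_pow₀ hD' (by omega))

end Taylor

/-! ### One step of the method -/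

section Step

variable {E : Type*} [NormedAddCommGroup E] [NormedSpace ℝ E] {k : ℕ}

/-- `w` is the local polynomial, in the variable scaled to `[0, 1]`, of a step of size `h` from
`Y`. -/
def IsStep (f : E → E) (c b : Fin k → ℝ) (s : ℕ) (h : ℝ) (Y : E) (w : ℝ → E) : Prop :=
  ∀ x : ℝ, w x = Y + h • ∑ j ∈ Finset.range s, (∫ τ in (0 : ℝ)..x, (legendreP j).eval τ) •
    ∑ i, (b i * (legendreP j).eval (c i)) • f (w (c i))

variable {f : E → E} {c b : Fin k → ℝ} {q s : ℕ} {h : ℝ} {Y : E} {w : ℝ → E}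

theorem IsStep.apply_zero (hw : IsStep f c b s h Y w) : w 0 = Y := by
  rw [hw 0]
  simp

theorem IsStep.hasDerivAt (hw : IsStep f c b s h Y w) (x : ℝ) :
    HasDerivAt w (h • legendreProj c b s (fun t => f (w t)) x) x := by
  rw [show w = _ from funext hw]
  refine HasDerivAt.const_add _ (HasDerivAt.const_smul h ?_)
  rw [← show w = _ from funext hw]
  refine HasDerivAt.fun_sum fun j _ => HasDerivAt.smul_const ?_ _
  exact ((legendreP j).continuous.integral_hasStrictDerivAt 0 x).hasDerivAt

theorem IsStep.deriv_eq (hw : IsStep f c b s h Y w) :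
    deriv w = fun x => h • legendreProj c b s (fun t => f (w t)) x :=
  funext fun x => (hw.hasDerivAt x).deriv

theorem IsStep.contDiff (hw : IsStep f c b s h Y w) (n : ℕ) : ContDiff ℝ n w := by
  have : ContDiff ℝ (⊤ : ℕ∞) w := by
    rw [contDiff_infty_iff_deriv, hw.deriv_eq]
    exact ⟨fun x => (hw.hasDerivAt x).differentiableAt,
      (contDiff_legendreProj c b s _).const_smul h⟩
  exact this.of_le (by exact_mod_cast le_top)

theorem nonempty_of_quadratureHasOrder (hord : QuadratureHasOrder c b q) (hq : 1 ≤ q) :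
    Nonempty (Fin k) := by
  by_contra hk
  rw [not_nonempty_iff] at hk
  have := hord 1 (by rw [Polynomial.natDegree_one]; omega)
  simp at this

variable [ProperSpace E] {L R : ℝ}

/-- The starting value `Y` is not assumed bounded, so the mean value inequality is anchored at a
node, where `R` is available. -/
theorem exists_norm_step_le (hf : Continuous f) (hk : Nonempty (Fin k))
    (hc : ∀ i, |c i| ≤ L) (s : ℕ) (b : Fin k → ℝ) (R : ℝ) :
    ∃ ρ, 0 ≤ ρ ∧ ∀ h : ℝ, 0 < h → h ≤ 1 → ∀ (Y : E) (w : ℝ → E), IsStep f c b s h Y w →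
      (∀ i, ‖w (c i)‖ ≤ R) → ∀ x ∈ Set.Icc (-L) L, ‖w x‖ ≤ ρ := by
  obtain ⟨A, hA0, hA⟩ := exists_norm_le_of_continuous hf R
  obtain ⟨M, hM0, hM⟩ := exists_norm_iteratedDeriv_legendreProj_le (E := E) c b s 0 L
  obtain ⟨i₀⟩ := hk
  refine ⟨max 0 (R + M * A * (2 * L)), le_max_left _ _, fun h h0 h1 Y w hw hR x hx => ?_⟩
  have hd : ∀ x ∈ Set.Icc (-L) L,
      ‖h • legendreProj c b s (fun t => f (w t)) x‖ ≤ M * A := by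
    intro x hx
    have := hM (fun t => f (w t)) A (fun i => hA _ (hR i)) x hx
    rw [iteratedDeriv_zero] at this
    rw [norm_smul, Real.norm_of_nonneg h0.le]
    exact (mul_le_of_le_one_left (norm_nonneg _) h1).trans this
  have hi : c i₀ ∈ Set.Icc (-L) L := abs_le.mp (hc i₀)
  have h2 := (convex_Icc (-L) L).norm_image_sub_le_of_norm_hasDerivWithin_le
    (fun x _ => (hw.hasDerivAt x).hasDerivWithinAt) hd hi hx
  have h3 : ‖x - c i₀‖ ≤ 2 * L := by
    rw [Real.norm_eq_abs, abs_le]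
    constructor <;> linarith [hi.1, hi.2, hx.1, hx.2]
  have h4 : ‖w x‖ ≤ ‖w (c i₀)‖ + ‖w x - w (c i₀)‖ := by
    simpa using norm_add_le (w (c i₀)) (w x - w (c i₀))
  refine le_max_of_le_right (h4.trans (add_le_add (hR i₀) (h2.trans ?_)))
  gcongr

/-- Each derivative gains one factor `h` from `w' = h Π(f ∘ w)`. The bounds up to order `r` control
the Taylor remainder of `f ∘ w`, and `Π` carries this over to the derivative of order `r + 1`. Only
derivatives of `f` of order below `s` are needed, since `w` has degree at most `s`. -/
theorem exists_norm_iteratedDeriv_step_le (hord : QuadratureHasOrder c b q) (hs : 1 ≤ s)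
    (hq : 2 * s ≤ q) (hf : ContDiff ℝ s f) (hL : 1 ≤ L) (hc : ∀ i, |c i| ≤ L) (R : ℝ) (r : ℕ) :
    ∃ C, 0 ≤ C ∧ ∀ h : ℝ, 0 < h → h ≤ 1 → ∀ (Y : E) (w : ℝ → E), IsStep f c b s h Y w →
      (∀ i, ‖w (c i)‖ ≤ R) → ∀ x ∈ Set.Icc (-L) L,
        ∀ i, 1 ≤ i → i ≤ r → ‖iteratedDeriv i w x‖ ≤ C * h ^ i := by
  obtain ⟨ρ, hρ0, hρ⟩ := exists_norm_step_le hf.continuous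
    (nonempty_of_quadratureHasOrder hord (by omega)) hc s b R
  induction r with
  | zero => exact ⟨0, le_rfl, fun h _ _ Y w _ _ x _ i hi1 hi => by omega⟩
  | succ r ih =>
    obtain ⟨C, hC0, hC⟩ := ih
    have hderiv : ∀ (h : ℝ) (Y : E) (w : ℝ → E), IsStep f c b s h Y w → ∀ x,
        iteratedDeriv (r + 1) w x =
          h • iteratedDeriv r (legendreProj c b s (fun t => f (w t))) x := by
      intro h Y w hw x
      rw [iteratedDeriv_succ', hw.deriv_eq]
      exact iteratedDeriv_fun_const_smul_field h _
    suffices hsuf : ∃ C', 0 ≤ C' ∧ ∀ h : ℝ, 0 < h → h ≤ 1 → ∀ (Y : E) (w : ℝ → E),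
        IsStep f c b s h Y w → (∀ i, ‖w (c i)‖ ≤ R) → ∀ x ∈ Set.Icc (-L) L,
        ‖iteratedDeriv r (legendreProj c b s (fun t => f (w t))) x‖ ≤ C' * h ^ r by
      obtain ⟨C', hC'0, hC'⟩ := hsuf
      refine ⟨max C C', le_max_of_le_left hC0, fun h h0 h1 Y w hw hR x hx i hi1 hi => ?_⟩
      rcases hi.eq_or_lt with rfl | hi
      · rw [hderiv h Y w hw, norm_smul, Real.norm_of_nonneg h0.le, pow_succ']
        have := hC' h h0 h1 Y w hw hR x hx
        calc h * ‖iteratedDeriv r (legendreProj c b s (fun t => f (w t))) x‖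
            ≤ h * (C' * h ^ r) := by gcongr
          _ = C' * (h * h ^ r) := by ring
          _ ≤ _ := by gcongr; exact le_max_right _ _
      · refine (hC h h0 h1 Y w hw hR x hx i hi1 (by omega)).trans ?_
        gcongr
        exact le_max_left _ _
    by_cases hrs : s ≤ r
    · refine ⟨0, le_rfl, fun h _ _ Y w _ _ x _ => ?_⟩
      rw [legendreProj, iteratedDeriv_polyCurve_eq_zero]
      · simp
      · intro j hj
        rw [natDegree_legendreP]
        omega
    · push Not at hrs
      have hfr : ContDiff ℝ r f := hf.of_le (by exact_mod_cast hrs.le)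
      obtain ⟨C₁, hC₁0, hC₁⟩ := exists_norm_iteratedDeriv_comp_le r hfr ρ C
      obtain ⟨M, hM0, hM⟩ := exists_norm_iteratedDeriv_legendreProj_le (E := E) c b s r L
      refine ⟨M * ((2 * L) ^ r * C₁), by positivity, fun h h0 h1 Y w hw hR x hx => ?_⟩
      have hwr := hw.contDiff r
      have hF : ∀ x ∈ Set.Icc (-L) L, ‖iteratedDeriv r (fun t => f (w t)) x‖ ≤ C₁ * h ^ r :=
        fun x hx => hC₁ h h0 w hwr x (hρ h h0 h1 Y w hw hR x hx)
          (hC h h0 h1 Y w hw hR x hx) r le_rfl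
      have hT := fun x hx => norm_sub_taylor_le hL r (hfr.comp hwr) hF (x := x) hx
      set a := fun i : ℕ => ((i.factorial : ℝ)⁻¹) • iteratedDeriv i (f ∘ w) (-L)
      set P := polyCurve r (fun i => (Polynomial.X + Polynomial.C L) ^ i) a with hP
      have hdeg : ∀ i < r, ((Polynomial.X + Polynomial.C L) ^ i).natDegree < r := fun i hi => by
        refine Polynomial.natDegree_pow_le.trans_lt ?_
        rw [Polynomial.natDegree_X_add_C, mul_one]
        exact hi
      -- The Taylor polynomial `P` has degree below `r < s`: it is fixed by the projection and
      -- killed by `r` derivatives, so only the remainder of size `h^r` counts.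
      have hsplit : legendreProj c b s (fun t => f (w t)) =
          legendreProj c b s (fun t => f (w t) - P t) + P := by
        ext x
        rw [Pi.add_apply, legendreProj_sub, hP,
          legendreProj_polyCurve hord hq r _ (fun i hi => (hdeg i hi).trans hrs) a]
        simp
      rw [hsplit, iteratedDeriv_add (contDiff_legendreProj c b s _).contDiffAt
        (contDiff_polyCurve _ _ _).contDiffAt, hP,
        iteratedDeriv_polyCurve_eq_zero r r _ a hdeg]
      rw [Pi.zero_apply, add_zero]
      refine (hM _ _ (fun i => hT (c i) (abs_le.mp (hc i))) x hx).trans (le_of_eq ?_)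
      ring

end Step

/-! ### The defect of a step -/

section Defect

variable {E : Type*} [NormedAddCommGroup E] [NormedSpace ℝ E] {k : ℕ}

/-- The defect of the local polynomial `w` in the scaled differential equation `w' = h f(w)`. -/
noncomputable def stepDefect (f : E → E) (c b : Fin k → ℝ) (s : ℕ) (h : ℝ) (w : ℝ → E) (x : ℝ) :
    E :=
  h • (legendreProj c b s (fun t => f (w t)) x - f (w x))

theorem natDegree_X_add_C_pow_le (L : ℝ) (i : ℕ) :
    ((Polynomial.X + Polynomial.C L : ℝ[X]) ^ i).natDegree ≤ i := by
  refine Polynomial.natDegree_pow_le.trans ?_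
  rw [Polynomial.natDegree_X_add_C, mul_one]

theorem continuous_stepDefect {f : E → E} (c b : Fin k → ℝ) (s : ℕ) (hf : Continuous f) {h : ℝ}
    {w : ℝ → E} (hw : Continuous w) :
    Continuous (stepDefect f c b s h w) := by
  unfold stepDefect
  have := (contDiff_legendreProj (N := 0) c b s (fun t => f (w t))).continuous
  fun_prop

variable {f : E → E} {c b : Fin k → ℝ} {q s : ℕ} [ProperSpace E] {L R : ℝ}

/-- Along a step, `f ∘ w` is close to polynomial curves of every degree less than the smoothness
of `f`. -/
theorem exists_step_taylor (hord : QuadratureHasOrder c b q) (hs : 1 ≤ s)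
    (hq : 2 * s ≤ q) (hf : ContDiff ℝ (2 * s : ℕ) f) (hL : 1 ≤ L) (hc : ∀ i, |c i| ≤ L) (R : ℝ)
    (r : ℕ) (hr : r ≤ 2 * s) :
    ∃ C, 0 ≤ C ∧ ∀ h : ℝ, 0 < h → h ≤ 1 → ∀ (Y : E) (w : ℝ → E), IsStep f c b s h Y w →
      (∀ i, ‖w (c i)‖ ≤ R) → ∃ a : ℕ → E, ∀ x ∈ Set.Icc (-L) L, ‖f (w x) -
        polyCurve r (fun i => (Polynomial.X + Polynomial.C L) ^ i) a x‖ ≤ C * h ^ r := by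
  obtain ⟨ρ, hρ0, hρ⟩ := exists_norm_step_le hf.continuous
    (nonempty_of_quadratureHasOrder hord (by omega)) hc s b R
  obtain ⟨C, hC0, hC⟩ := exists_norm_iteratedDeriv_step_le hord hs hq
    (hf.of_le (by exact_mod_cast (by omega : s ≤ 2 * s))) hL hc R r
  have hfr : ContDiff ℝ r f := hf.of_le (by exact_mod_cast hr)
  obtain ⟨C₁, hC₁0, hC₁⟩ := exists_norm_iteratedDeriv_comp_le r hfr ρ C
  refine ⟨(2 * L) ^ r * C₁, by positivity, fun h h0 h1 Y w hw hR => ?_⟩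
  have hwr := hw.contDiff r
  have hF : ∀ x ∈ Set.Icc (-L) L, ‖iteratedDeriv r (fun t => f (w t)) x‖ ≤ C₁ * h ^ r :=
    fun x hx => hC₁ h h0 w hwr x (hρ h h0 h1 Y w hw hR x hx)
      (hC h h0 h1 Y w hw hR x hx) r le_rfl
  refine ⟨fun i => ((i.factorial : ℝ)⁻¹) • iteratedDeriv i (f ∘ w) (-L), fun x hx => ?_⟩
  rw [mul_assoc]
  exact norm_sub_taylor_le hL r (hfr.comp hwr) hF hx

/-- The operator `Π - 1` annihilates the Taylor polynomial of degree below `s`, which leaves a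
remainder `O(h^s)` and the prefactor `h`. -/
theorem exists_norm_stepDefect_le (hord : QuadratureHasOrder c b q) (hs : 1 ≤ s)
    (hq : 2 * s ≤ q) (hf : ContDiff ℝ (2 * s : ℕ) f) (hL : 1 ≤ L) (hc : ∀ i, |c i| ≤ L) (R : ℝ) :
    ∃ C, 0 ≤ C ∧ ∀ h : ℝ, 0 < h → h ≤ 1 → ∀ (Y : E) (w : ℝ → E), IsStep f c b s h Y w →
      (∀ i, ‖w (c i)‖ ≤ R) → ∀ x ∈ Set.Icc (-L) L,
        ‖stepDefect f c b s h w x‖ ≤ C * h ^ (s + 1) := by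
  obtain ⟨C, hC0, hC⟩ := exists_step_taylor hord hs hq hf hL hc R s (by omega)
  obtain ⟨M, hM0, hM⟩ := exists_norm_iteratedDeriv_legendreProj_le (E := E) c b s 0 L
  refine ⟨(M + 1) * C, by positivity, fun h h0 h1 Y w hw hR x hx => ?_⟩
  obtain ⟨a, ha⟩ := hC h h0 h1 Y w hw hR
  set P := polyCurve s (fun i => (Polynomial.X + Polynomial.C L) ^ i) a with hP
  have hsplit : legendreProj c b s (fun t => f (w t)) x - f (w x) =
      legendreProj c b s (fun t => f (w t) - P t) x - (f (w x) - P x) := by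
    rw [legendreProj_sub, hP, legendreProj_polyCurve hord hq s _
      (fun i hi => (natDegree_X_add_C_pow_le L i).trans_lt hi) a]
    abel
  have h2 := hM (fun t => f (w t) - P t) _ (fun i => ha (c i) (abs_le.mp (hc i))) x hx
  rw [iteratedDeriv_zero] at h2
  rw [stepDefect, norm_smul, Real.norm_of_nonneg h0.le, hsplit]
  calc h * ‖_‖ ≤ h * (M * (C * h ^ s) + C * h ^ s) :=
        mul_le_mul_of_nonneg_left ((norm_sub_le _ _).trans (add_le_add h2 (ha x hx))) h0.le
    _ = _ := by ring

/-- The moment is `h` times the quadrature error for `(x + L)^n f(w(x))`. Since degree `n` is used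
up by the weight, `f ∘ w` may be replaced only by polynomials of degree below `2s - n`. The factor
`h^n` on the left stands for the `n`-th Taylor coefficient of a slowly varying weight. -/
theorem exists_norm_integral_pow_smul_stepDefect_le (hord : QuadratureHasOrder c b q) (hs : 1 ≤ s)
    (hq : 2 * s ≤ q) (hf : ContDiff ℝ (2 * s : ℕ) f) (hL : 1 ≤ L) (hc : ∀ i, |c i| ≤ L) (R : ℝ)
    (n : ℕ) (hn : n < s) :
    ∃ C, 0 ≤ C ∧ ∀ h : ℝ, 0 < h → h ≤ 1 → ∀ (Y : E) (w : ℝ → E), IsStep f c b s h Y w →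
      (∀ i, ‖w (c i)‖ ≤ R) →
        ‖∫ x in (0 : ℝ)..1, (x + L) ^ n • stepDefect f c b s h w x‖ * h ^ n ≤
          C * h ^ (2 * s + 1) := by
  obtain ⟨C, hC0, hC⟩ := exists_step_taylor hord hs hq hf hL hc R (2 * s - n) (by omega)
  have hdeg := natDegree_X_add_C_pow_le L n
  obtain ⟨M, hM0, hM⟩ := exists_norm_quadrature_sub_integral_le (E := E) hord hL hc
    ((Polynomial.X + Polynomial.C L) ^ n) (2 * s - n) (by omega)
  refine ⟨M * C, by positivity, fun h h0 h1 Y w hw hR => ?_⟩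
  obtain ⟨a, ha⟩ := hC h h0 h1 Y w hw hR
  have hwc : Continuous w := (hw.contDiff 0).continuous
  have hF : Continuous fun x => f (w x) := hf.continuous.comp hwc
  have h2 := hM _ a _ hF ha
  rw [← integral_eval_smul_legendreProj (s := s) _ (hdeg.trans_lt hn) (fun t => f (w t))] at h2
  have hcl := (contDiff_legendreProj (N := 0) c b s (fun t => f (w t))).continuous
  rw [← intervalIntegral.integral_sub (Continuous.intervalIntegrable (by fun_prop) _ _)
    (Continuous.intervalIntegrable (by fun_prop) _ _)] at h2
  have h3 : ∀ x, (x + L) ^ n • stepDefect f c b s h w x =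
      h • ((((Polynomial.X + Polynomial.C L) ^ n : ℝ[X]).eval x) •
        legendreProj c b s (fun t => f (w t)) x -
        (((Polynomial.X + Polynomial.C L) ^ n : ℝ[X]).eval x) • f (w x)) := by
    intro x
    rw [stepDefect, ← smul_sub, smul_comm]
    simp
  simp_rw [h3]
  rw [intervalIntegral.integral_smul, norm_smul, Real.norm_of_nonneg h0.le]
  have h4 : h ^ (2 * s + 1) = h * h ^ (2 * s - n) * h ^ n := by
    rw [mul_assoc, ← pow_add, ← pow_succ']
    congr 1
    omega
  calc h * ‖_‖ * h ^ n ≤ h * (M * (C * h ^ (2 * s - n))) * h ^ n := by gcongr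
    _ = _ := by rw [h4]; ring

/-- Superconvergence: the defect is almost orthogonal to slowly varying functions. -/
theorem exists_norm_integral_clm_stepDefect_le (hord : QuadratureHasOrder c b q) (hs : 1 ≤ s)
    (hq : 2 * s ≤ q) (hf : ContDiff ℝ (2 * s : ℕ) f) (hL : 1 ≤ L) (hc : ∀ i, |c i| ≤ L) (R B : ℝ)
    (hB : 0 ≤ B) :
    ∃ C, 0 ≤ C ∧ ∀ h : ℝ, 0 < h → h ≤ 1 → ∀ (Y : E) (w : ℝ → E), IsStep f c b s h Y w →
      (∀ i, ‖w (c i)‖ ≤ R) → ∀ G : ℝ → E →L[ℝ] E, ContDiff ℝ s G →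
      (∀ x ∈ Set.Icc (-L) L, ∀ i ≤ s, ‖iteratedDeriv i G x‖ ≤ B * h ^ i) →
        ‖∫ x in (0 : ℝ)..1, G x (stepDefect f c b s h w x)‖ ≤ C * h ^ (2 * s + 1) := by
  obtain ⟨C, hC0, hC⟩ := exists_norm_stepDefect_le hord hs hq hf hL hc R
  have hmom : ∀ n, ∃ D, 0 ≤ D ∧ (n < s → ∀ h : ℝ, 0 < h → h ≤ 1 → ∀ (Y : E) (w : ℝ → E),
      IsStep f c b s h Y w → (∀ i, ‖w (c i)‖ ≤ R) →
        ‖∫ x in (0 : ℝ)..1, (x + L) ^ n • stepDefect f c b s h w x‖ * h ^ n ≤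
          D * h ^ (2 * s + 1)) := by
    intro n
    by_cases hn : n < s
    · obtain ⟨D, h0, hD⟩ := exists_norm_integral_pow_smul_stepDefect_le hord hs hq hf hL hc R n hn
      exact ⟨D, h0, fun _ => hD⟩
    · exact ⟨0, le_rfl, fun h => absurd h hn⟩
  choose D hD0 hD using hmom
  refine ⟨(2 * L) ^ s * B * C + ∑ n ∈ Finset.range s, B * D n,
    add_nonneg (by positivity) (Finset.sum_nonneg fun n _ => mul_nonneg hB (hD0 n)),
    fun h h0 h1 Y w hw hR G hG hGB => ?_⟩
  set d := stepDefect f c b s h w with hd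
  have hdc : Continuous d := continuous_stepDefect c b s hf.continuous (hw.contDiff 0).continuous
  set a := fun i : ℕ => ((i.factorial : ℝ)⁻¹) • iteratedDeriv i G (-L) with ha
  set P := polyCurve s (fun i => (Polynomial.X + Polynomial.C L) ^ i) a with hP
  have hPc : Continuous P := continuous_polyCurve _ _ _
  have hGc : Continuous G := hG.continuous
  have hT : ∀ x ∈ Set.Icc (-L) L, ‖G x - P x‖ ≤ (2 * L) ^ s * (B * h ^ s) := fun x hx =>
    norm_sub_taylor_le hL s hG (fun x hx => hGB x hx s le_rfl) hx
  have hleft : -L ∈ Set.Icc (-L) L := Set.left_mem_Icc.mpr (by linarith)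
  have haB : ∀ i < s, ‖a i‖ ≤ B * h ^ i := by
    intro i hi
    have h4 : (1 : ℝ) ≤ i.factorial := by
      exact_mod_cast Nat.one_le_iff_ne_zero.mpr i.factorial_ne_zero
    rw [ha, norm_smul, norm_inv, Real.norm_of_nonneg (by positivity)]
    exact (mul_le_of_le_one_left (norm_nonneg _) (inv_le_one_of_one_le₀ h4)).trans
      (hGB _ hleft i hi.le)
  -- The Taylor remainder of `G` meets the pointwise bound, giving `h^s h^(s+1)`; the polynomial
  -- part meets the moment bounds.
  have hsplit : ∫ x in (0 : ℝ)..1, G x (d x) = (∫ x in (0 : ℝ)..1, (G x - P x) (d x)) +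
      ∑ n ∈ Finset.range s, a n (∫ x in (0 : ℝ)..1, (x + L) ^ n • d x) := by
    have h5 : ∀ n ∈ Finset.range s, a n (∫ x in (0 : ℝ)..1, (x + L) ^ n • d x) =
        ∫ x in (0 : ℝ)..1, a n ((x + L) ^ n • d x) := fun n _ =>
      ((a n).intervalIntegral_comp_comm
        (Continuous.intervalIntegrable (by fun_prop) _ _)).symm
    rw [Finset.sum_congr rfl h5, ← intervalIntegral.integral_finsetSum
      fun i _ => Continuous.intervalIntegrable (by fun_prop) _ _,
      ← intervalIntegral.integral_add (Continuous.intervalIntegrable (by fun_prop) _ _)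
        (Continuous.intervalIntegrable (by fun_prop) _ _)]
    refine intervalIntegral.integral_congr fun x _ => ?_
    simp [hP, polyCurve]
  rw [hsplit, add_mul]
  refine (norm_add_le _ _).trans (add_le_add ?_ ?_)
  · have h6 := intervalIntegral.norm_integral_le_of_norm_le_const (a := 0) (b := 1)
      (f := fun x => (G x - P x) (d x))
      (C := ((2 * L) ^ s * (B * h ^ s)) * (C * h ^ (s + 1))) ?_
    · refine h6.trans (le_of_eq ?_)
      rw [sub_zero, abs_one, mul_one, show 2 * s + 1 = s + (s + 1) by ring, pow_add]
      ring
    · intro x hx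
      rw [Set.uIoc_of_le zero_le_one] at hx
      have hxL : x ∈ Set.Icc (-L) L := ⟨by linarith [hx.1], hx.2.trans hL⟩
      exact (ContinuousLinearMap.le_opNorm _ _).trans
        (mul_le_mul (hT x hxL) (hC h h0 h1 Y w hw hR x hxL) (norm_nonneg _) (by positivity))
  · rw [Finset.sum_mul]
    refine (norm_sum_le _ _).trans (Finset.sum_le_sum fun n hn => ?_)
    have hn := Finset.mem_range.mp hn
    calc ‖a n (∫ x in (0 : ℝ)..1, (x + L) ^ n • d x)‖
        ≤ (B * h ^ n) * ‖∫ x in (0 : ℝ)..1, (x + L) ^ n • d x‖ :=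
          (ContinuousLinearMap.le_opNorm _ _).trans
            (mul_le_mul_of_nonneg_right (haB n hn) (norm_nonneg _))
      _ = B * (‖∫ x in (0 : ℝ)..1, (x + L) ^ n • d x‖ * h ^ n) := by ring
      _ ≤ B * (D n * h ^ (2 * s + 1)) :=
          mul_le_mul_of_nonneg_left (hD n hn h h0 h1 Y w hw hR) hB
      _ = _ := by ring

end Defect

/-! ### An approximate resolvent -/

section Resolvent

variable {E : Type*} [NormedAddCommGroup E] [NormedSpace ℝ E] [CompleteSpace E]

theorem norm_iteratedDeriv_mul_le {A : Type*} [NormedRing A] [NormedAlgebra ℝ A] {F G : ℝ → A}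
    {r j : ℕ} (hF : ContDiff ℝ r F) (hG : ContDiff ℝ r G) (hj : j ≤ r) {x h B C : ℝ} (h0 : 0 < h)
    (hB : 0 ≤ B)
    (hFB : ∀ i ≤ r, ‖iteratedDeriv i F x‖ ≤ B * h ^ i)
    (hGC : ∀ i ≤ r, ‖iteratedDeriv i G x‖ ≤ C * h ^ i) :
    ‖iteratedDeriv j (fun t => F t * G t) x‖ ≤ 2 ^ j * B * C * h ^ j := by
  have h1 := norm_iteratedFDeriv_mul_le hF hG x (n := j) (by exact_mod_cast hj)
  simp_rw [norm_iteratedFDeriv_eq_norm_iteratedDeriv] at h1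
  refine h1.trans ?_
  have h2 : (2 : ℝ) ^ j = ∑ i ∈ Finset.range (j + 1), (j.choose i : ℝ) := by
    exact_mod_cast (Nat.sum_range_choose j).symm
  rw [h2, Finset.sum_mul, Finset.sum_mul, Finset.sum_mul]
  refine Finset.sum_le_sum fun i hi => ?_
  have hi := Finset.mem_range.mp hi
  calc (j.choose i : ℝ) * ‖iteratedDeriv i F x‖ * ‖iteratedDeriv (j - i) G x‖
      ≤ (j.choose i : ℝ) * (B * h ^ i) * (C * h ^ (j - i)) := by
        gcongr
        · exact hFB i (by omega)
        · exact hGC (j - i) (by omega)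
    _ = (j.choose i : ℝ) * B * C * (h ^ i * h ^ (j - i)) := by ring
    _ = _ := by rw [← pow_add, Nat.add_sub_cancel' (by omega)]

/-- An approximate solution of `G' = -h G A`, `G(1) = 1`, with slowly varying derivatives. -/
theorem exists_approx_resolvent {L : ℝ} (hL : 1 ≤ L) (r : ℕ) {B : ℝ} (hB : 0 ≤ B) (n : ℕ) :
    ∃ C, 0 ≤ C ∧ ∀ h : ℝ, 0 < h → h ≤ 1 → ∀ A : ℝ → E →L[ℝ] E, ContDiff ℝ r A →
      (∀ x ∈ Set.Icc (-L) L, ∀ i ≤ r, ‖iteratedDeriv i A x‖ ≤ B * h ^ i) →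
      ∃ G G' : ℝ → E →L[ℝ] E, ContDiff ℝ r G ∧ G 1 = 1 ∧ (∀ x, HasDerivAt G (G' x) x) ∧
        (∀ x ∈ Set.Icc (-L) L, ∀ i ≤ r, ‖iteratedDeriv i G x‖ ≤ C * h ^ i) ∧
        (∀ x ∈ Set.Icc (-L) L, ‖G' x + h • (G x * A x)‖ ≤ C * h ^ (n + 1)) := by
  have h1L : (1 : ℝ) ∈ Set.Icc (-L) L := ⟨by linarith, hL⟩
  induction n with
  | zero =>
    -- The iteration starts from the constant `1`, with residual `h A`.
    refine ⟨1 + B, by positivity, fun h h0 h1 A hA hAB => ?_⟩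
    refine ⟨fun _ => 1, fun _ => 0, contDiff_const, rfl, fun x => hasDerivAt_const _ _,
      fun x _ i _ => ?_, fun x hx => ?_⟩
    · rw [iteratedDeriv_const]
      split_ifs with hi
      · subst hi
        rw [pow_zero, mul_one]
        exact ContinuousLinearMap.norm_id_le.trans (by linarith)
      · rw [norm_zero]
        positivity
    · have := hAB x hx 0 (Nat.zero_le _)
      rw [iteratedDeriv_zero, pow_zero, mul_one] at this
      rw [zero_add, one_mul, norm_smul, Real.norm_of_nonneg h0.le, zero_add, pow_one, mul_comm]
      gcongr
      linarith
  | succ n ih =>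
    obtain ⟨C, hC0, hC⟩ := ih
    -- The summands bound, in order, the size of the new iterate (the first two), its derivatives by
    -- the Leibniz rule, and its residual.
    refine ⟨1 + C * B * (2 * L) + 2 ^ r * C * B + C * (2 * L) * B, by positivity,
      fun h h0 h1 A hA hAB => ?_⟩
    obtain ⟨G, G', hG, hG1, hGd, hGb, hGres⟩ := hC h h0 h1 A hA hAB
    have hGA : ContDiff ℝ r fun x => G x * A x := hG.mul hA
    have hA0 : ∀ x ∈ Set.Icc (-L) L, ‖A x‖ ≤ B := fun x hx => by
      simpa using hAB x hx 0 (Nat.zero_le _)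
    have hG0 : ∀ x ∈ Set.Icc (-L) L, ‖G x‖ ≤ C := fun x hx => by
      simpa using hGb x hx 0 (Nat.zero_le _)
    -- One Picard step. Its residual is `h (H - G) A`, and `H - G` vanishes at `1` with derivative
    -- minus the old residual, so one power of `h` is gained.
    set H : ℝ → E →L[ℝ] E := fun x => 1 - h • ∫ τ in (1 : ℝ)..x, G τ * A τ with hH
    have hHd : ∀ x, HasDerivAt H (-(h • (G x * A x))) x := fun x => by
      have h2 := (hGA.continuous.integral_hasStrictDerivAt 1 x).hasDerivAt
      exact (h2.const_smul h).const_sub 1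
    have hderiv : deriv H = fun x => (-h) • (G x * A x) := by
      funext x
      rw [(hHd x).deriv, neg_smul]
    have hHc : ContDiff ℝ r H := by
      have : ContDiff ℝ (r + 1) H := by
        rw [contDiff_succ_iff_deriv, hderiv]
        exact ⟨fun x => (hHd x).differentiableAt, by simp, hGA.const_smul (-h)⟩
      exact this.of_le le_self_add
    have hlen : ∀ x ∈ Set.Icc (-L) L, |x - 1| ≤ 2 * L := fun x hx => by
      rw [abs_le]
      constructor <;> linarith [hx.1, hx.2]
    have hH1 : H 1 = 1 := by simp [hH]
    clear_value H
    refine ⟨H, fun x => -(h • (G x * A x)), hHc, hH1, hHd, fun x hx i hi => ?_, fun x hx => ?_⟩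
    · cases i with
      | zero =>
        rw [iteratedDeriv_zero, pow_zero, mul_one]
        have h3 := (convex_Icc (-L) L).norm_image_sub_le_of_norm_hasDerivWithin_le
          (C := C * B) (fun x _ => (hHd x).hasDerivWithinAt) (fun x hx => by
            rw [norm_neg, norm_smul, Real.norm_of_nonneg h0.le]
            refine (mul_le_of_le_one_left (norm_nonneg _) h1).trans ((norm_mul_le _ _).trans ?_)
            exact mul_le_mul (hG0 x hx) (hA0 x hx) (norm_nonneg _) hC0) h1L hx
        rw [hH1, Real.norm_eq_abs] at h3
        have h4 : ‖H x‖ ≤ ‖(1 : E →L[ℝ] E)‖ + ‖H x - 1‖ := by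
          simpa using norm_add_le (1 : E →L[ℝ] E) (H x - 1)
        have h5 : ‖(1 : E →L[ℝ] E)‖ ≤ 1 := ContinuousLinearMap.norm_id_le
        have h6 : C * B * |x - 1| ≤ C * B * (2 * L) := by
          have := hlen x hx
          gcongr
        have h7 : 0 ≤ 2 ^ r * C * B + C * (2 * L) * B := by positivity
        linarith
      | succ i =>
        rw [iteratedDeriv_succ', hderiv, iteratedDeriv_fun_const_smul_field, norm_smul, norm_neg,
          Real.norm_of_nonneg h0.le]
        have h3 := norm_iteratedDeriv_mul_le hG hA (by omega : i ≤ r) h0 hC0 (hGb x hx) (hAB x hx)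
        calc h * ‖_‖ ≤ h * (2 ^ i * C * B * h ^ i) := mul_le_mul_of_nonneg_left h3 h0.le
          _ = 2 ^ i * C * B * h ^ (i + 1) := by ring
          _ ≤ 2 ^ r * C * B * h ^ (i + 1) := by
            have : (2 : ℝ) ^ i ≤ 2 ^ r := pow_le_pow_right₀ one_le_two (by omega)
            gcongr
          _ ≤ _ := by
            have h7 : 0 ≤ 1 + C * B * (2 * L) := by positivity
            have h8 : 0 ≤ C * (2 * L) * B := by positivity
            gcongr
            linarith
    · have h3 := (convex_Icc (-L) L).norm_image_sub_le_of_norm_hasDerivWithin_le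
        (f := fun x => H x - G x) (C := C * h ^ (n + 1))
        (fun x _ => ((hHd x).sub (hGd x)).hasDerivWithinAt) (fun x hx => by
          have := hGres x hx
          rwa [← norm_neg, neg_add_rev, ← sub_eq_add_neg] at this) h1L hx
      simp only [hH1, hG1, sub_self, sub_zero, Real.norm_eq_abs] at h3
      have h4 : -(h • (G x * A x)) + h • (H x * A x) = h • ((H x - G x) * A x) := by
        rw [sub_mul, smul_sub]
        abel
      rw [h4, norm_smul, Real.norm_of_nonneg h0.le]
      have h5 : ‖H x - G x‖ ≤ C * h ^ (n + 1) * (2 * L) :=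
        h3.trans (mul_le_mul_of_nonneg_left (hlen x hx) (by positivity))
      calc h * ‖(H x - G x) * A x‖ ≤ h * (C * h ^ (n + 1) * (2 * L) * B) :=
            mul_le_mul_of_nonneg_left ((norm_mul_le _ _).trans
              (mul_le_mul h5 (hA0 x hx) (norm_nonneg _) (by positivity))) h0.le
        _ = C * (2 * L) * B * h ^ (n + 1 + 1) := by ring
        _ ≤ _ := by
          have h7 : 0 ≤ 1 + C * B * (2 * L) + 2 ^ r * C * B := by positivity
          gcongr
          linarith

end Resolvent

/-! ### The error of one step -/

section OneStep

variable {E : Type*} [NormedAddCommGroup E] [NormedSpace ℝ E] [ProperSpace E]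

theorem exists_lipschitz_on_ball {V : Type*} [NormedAddCommGroup V] [NormedSpace ℝ V] {g : E → V}
    (hg : ContDiff ℝ 1 g) (ρ : ℝ) :
    ∃ K, 0 ≤ K ∧ ∀ x y, ‖x‖ ≤ ρ → ‖y‖ ≤ ρ → ‖g x - g y‖ ≤ K * ‖x - y‖ := by
  obtain ⟨K, hK0, hK⟩ := exists_norm_le_of_continuous (hg.continuous_fderiv one_ne_zero) ρ
  refine ⟨K, hK0, fun x y hx hy => ?_⟩
  exact (convex_closedBall (0 : E) ρ).norm_image_sub_le_of_norm_fderiv_le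
    (fun z _ => (hg.differentiable one_ne_zero) z) (fun z hz => hK z (by simpa using hz))
    (by simpa using hy) (by simpa using hx)

theorem exists_norm_sub_fderiv_le {g : E → E} (hg : ContDiff ℝ 2 g) (ρ : ℝ) :
    ∃ K, 0 ≤ K ∧ ∀ x y, ‖x‖ ≤ ρ → ‖y‖ ≤ ρ →
      ‖g y - g x - fderiv ℝ g x (y - x)‖ ≤ K * ‖y - x‖ ^ 2 := by
  obtain ⟨K, hK0, hK⟩ := exists_lipschitz_on_ball
    (hg.fderiv_right (m := 1) (by norm_num)) ρ
  refine ⟨K, hK0, fun x y hx hy => ?_⟩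
  have hseg : ∀ z ∈ segment ℝ x y, ‖z‖ ≤ ρ := fun z hz => by
    have := (convex_closedBall (0 : E) ρ).segment_subset (x := x) (y := y) (by simpa using hx)
      (by simpa using hy) hz
    simpa using this
  have h1 := (convex_segment x y).norm_image_sub_le_of_norm_hasFDerivWithin_le' (f := g)
    (φ := fderiv ℝ g x) (C := K * ‖y - x‖)
    (fun z _ => ((hg.differentiable two_ne_zero) z).hasFDerivAt.hasFDerivWithinAt)
    (fun z hz => by
      refine (hK z x (hseg z hz) hx).trans ?_
      gcongr
      exact norm_sub_le_of_mem_segment hz) (left_mem_segment ℝ x y) (right_mem_segment ℝ x y)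
  rw [pow_two, ← mul_assoc]
  exact h1

variable {k : ℕ} {f : E → E} {c b : Fin k → ℝ} {q s : ℕ} {L : ℝ}

/-- Gronwall's inequality for `z - w`, driven by the pointwise defect. It loses the
superconvergence, but suffices for the terms where the error is multiplied by a small factor. -/
theorem exists_norm_sub_step_le (hord : QuadratureHasOrder c b q) (hs : 1 ≤ s)
    (hq : 2 * s ≤ q) (hf : ContDiff ℝ (2 * s : ℕ) f) (hL : 1 ≤ L) (hc : ∀ i, |c i| ≤ L)
    (R ρ : ℝ) :
    ∃ C, 0 ≤ C ∧ ∀ h : ℝ, 0 < h → h ≤ 1 → ∀ (Y : E) (w : ℝ → E), IsStep f c b s h Y w →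
      (∀ i, ‖w (c i)‖ ≤ R) → ∀ z : ℝ → E,
      (∀ x ∈ Set.Icc (0 : ℝ) 1, HasDerivWithinAt z (h • f (z x)) (Set.Icc 0 1) x) →
      (∀ x ∈ Set.Icc (0 : ℝ) 1, ‖z x‖ ≤ ρ) →
      ∀ x ∈ Set.Icc (0 : ℝ) 1, ‖z x - w x‖ ≤ C * (‖z 0 - Y‖ + h ^ (s + 1)) := by
  have hf1 : ContDiff ℝ 1 f := hf.of_le (by exact_mod_cast (by omega : 1 ≤ 2 * s))
  obtain ⟨ρ', -, hρ'⟩ := exists_norm_step_le hf.continuous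
    (nonempty_of_quadratureHasOrder hord (by omega)) hc s b R
  obtain ⟨D, hD0, hD⟩ := exists_norm_stepDefect_le hord hs hq hf hL hc R
  obtain ⟨K, hK0, hK⟩ := exists_lipschitz_on_ball hf1 (max ρ ρ')
  refine ⟨(1 + D) * Real.exp (K + 1), by positivity, fun h h0 h1 Y w hw hR z hz hzρ x hx => ?_⟩
  have hsub : Set.Icc (0 : ℝ) 1 ⊆ Set.Icc (-L) L := Set.Icc_subset_Icc (by linarith) hL
  have hd : ∀ x ∈ Set.Icc (0 : ℝ) 1, HasDerivWithinAt (fun t => z t - w t)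
      (h • (f (z x) - f (w x)) - stepDefect f c b s h w x) (Set.Icc 0 1) x := fun x hx => by
    have := (hz x hx).sub (hw.hasDerivAt x).hasDerivWithinAt
    rw [show h • (f (z x) - f (w x)) - stepDefect f c b s h w x =
        h • f (z x) - h • legendreProj c b s (fun t => f (w t)) x by
      simp only [stepDefect, smul_sub]
      abel]
    exact this
  -- Using `K + 1` instead of `K` keeps the exponent nonzero and makes division by it harmless.
  have h2 := norm_le_gronwallBound_of_norm_deriv_right_le (a := 0) (b := 1)
    (f := fun t => z t - w t) (δ := ‖z 0 - Y‖) (K := K + 1) (ε := D * h ^ (s + 1))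
    (fun x hx => (hd x hx).continuousWithinAt)
    (fun x hx => (hd x ⟨hx.1, hx.2.le⟩).mono_of_mem_nhdsWithin (Icc_mem_nhdsGE_of_mem hx))
    (by rw [hw.apply_zero]) (fun x hx => by
      have hx : x ∈ Set.Icc (0 : ℝ) 1 := ⟨hx.1, hx.2.le⟩
      refine (norm_sub_le _ _).trans (add_le_add ?_ (hD h h0 h1 Y w hw hR x (hsub hx)))
      rw [norm_smul, Real.norm_of_nonneg h0.le]
      refine (mul_le_of_le_one_left (norm_nonneg _) h1).trans
        ((hK _ _ (le_max_of_le_left (hzρ x hx))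
          (le_max_of_le_right (hρ' h h0 h1 Y w hw hR x (hsub hx)))).trans ?_)
      gcongr
      linarith) x hx
  refine h2.trans ?_
  have hKne : K + 1 ≠ 0 := by positivity
  rw [gronwallBound_of_K_ne_0 hKne, sub_zero]
  have hexp : Real.exp ((K + 1) * x) ≤ Real.exp (K + 1) := by
    rw [Real.exp_le_exp]
    exact mul_le_of_le_one_right (by positivity) hx.2
  have hdiv : D * h ^ (s + 1) / (K + 1) ≤ D * h ^ (s + 1) :=
    div_le_self (by positivity) (by linarith)
  have h1exp : 1 ≤ Real.exp ((K + 1) * x) := Real.one_le_exp (mul_nonneg (by positivity) hx.1)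
  calc ‖z 0 - Y‖ * Real.exp ((K + 1) * x) +
        D * h ^ (s + 1) / (K + 1) * (Real.exp ((K + 1) * x) - 1)
      ≤ ‖z 0 - Y‖ * Real.exp (K + 1) + D * h ^ (s + 1) * Real.exp (K + 1) := by
        refine add_le_add (by gcongr) (mul_le_mul hdiv (by linarith) (by linarith) (by positivity))
    _ ≤ (1 + D) * Real.exp (K + 1) * (‖z 0 - Y‖ + h ^ (s + 1)) := by
        have e1 : 0 ≤ D * Real.exp (K + 1) * ‖z 0 - Y‖ := by positivity
        have e2 : 0 ≤ Real.exp (K + 1) * h ^ (s + 1) := by positivity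
        linarith

/-- Testing the error equation with the approximate resolvent removes the linear term up to a
residual, so the defect enters only through `∫ G d`. The factor `h` before the initial error comes
from `G(0) - 1 = O(h)`. -/
theorem exists_norm_error_increment_le (hord : QuadratureHasOrder c b q) (hs : 1 ≤ s)
    (hq : 2 * s ≤ q) (hf : ContDiff ℝ (2 * s : ℕ) f) (hL : 1 ≤ L) (hc : ∀ i, |c i| ≤ L)
    (R ρ : ℝ) :
    ∃ C, 0 ≤ C ∧ ∀ h : ℝ, 0 < h → h ≤ 1 → ∀ (Y : E) (w : ℝ → E), IsStep f c b s h Y w →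
      (∀ i, ‖w (c i)‖ ≤ R) → ∀ z : ℝ → E,
      (∀ x ∈ Set.Icc (0 : ℝ) 1, HasDerivWithinAt z (h • f (z x)) (Set.Icc 0 1) x) →
      (∀ x ∈ Set.Icc (0 : ℝ) 1, ‖z x‖ ≤ ρ) →
      ‖(z 1 - w 1) - (z 0 - Y)‖ ≤ C * (h * ‖z 0 - Y‖ + h ^ (2 * s + 1)) := by
  have hf2 : ContDiff ℝ 2 f := hf.of_le (by exact_mod_cast (by omega : 2 ≤ 2 * s))
  have hfs : ContDiff ℝ s f := hf.of_le (by exact_mod_cast (by omega : s ≤ 2 * s))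
  have hDf : ContDiff ℝ s (fderiv ℝ f) :=
    hf.fderiv_right (by exact_mod_cast (by omega : s + 1 ≤ 2 * s))
  obtain ⟨ρ', -, hρ'⟩ := exists_norm_step_le hf.continuous
    (nonempty_of_quadratureHasOrder hord (by omega)) hc s b R
  obtain ⟨Ce, hCe0, hCe⟩ := exists_norm_sub_step_le hord hs hq hf hL hc R ρ
  obtain ⟨Q, hQ0, hQ⟩ := exists_norm_sub_fderiv_le hf2 (max ρ ρ')
  obtain ⟨W, hW0, hW⟩ := exists_norm_iteratedDeriv_step_le hord hs hq hfs hL hc R s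
  obtain ⟨B, hB0, hB⟩ := exists_norm_iteratedDeriv_comp_le s hDf ρ' W
  obtain ⟨Cg, hCg0, hCg⟩ := exists_approx_resolvent (E := E) hL s hB0 s
  obtain ⟨Cd, hCd0, hCd⟩ := exists_norm_integral_clm_stepDefect_le hord hs hq hf hL hc R Cg hCg0
  set Δ := |ρ| + |ρ'| with hΔ
  refine ⟨Cg + Cd + Cg * Ce + 2 * Cg * Q * Ce ^ 2 * (Δ + 1), by positivity,
    fun h h0 h1 Y w hw hR z hz hzρ => ?_⟩
  have hsub : Set.Icc (0 : ℝ) 1 ⊆ Set.Icc (-L) L := Set.Icc_subset_Icc (by linarith) hL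
  have hwρ := hρ' h h0 h1 Y w hw hR
  have hws := hw.contDiff s
  have hwc : Continuous w := hws.continuous
  obtain ⟨G, G', hG, hG1, hGd, hGb, hGres⟩ := hCg h h0 h1 (fun t => fderiv ℝ f (w t))
    (hDf.comp hws) (fun x hx i hi => hB h h0 w hws x (hwρ x hx)
      (hW h h0 h1 Y w hw hR x hx) i hi)
  have hint := hCd h h0 h1 Y w hw hR G hG hGb
  have hG0 : ∀ x ∈ Set.Icc (-L) L, ‖G x‖ ≤ Cg := fun x hx => by
    simpa using hGb x hx 0 (Nat.zero_le _)
  have hGc := hG.continuous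
  have h0m : (0 : ℝ) ∈ Set.Icc (0 : ℝ) 1 := ⟨le_rfl, zero_le_one⟩
  set d := stepDefect f c b s h w with hdd
  have hdc : Continuous d := continuous_stepDefect c b s hf.continuous hwc
  set δ := ‖z 0 - Y‖ with hδ
  have hδ0 : 0 ≤ δ := norm_nonneg _
  -- Crude, but it lets `h δ^2` be absorbed into `h δ` without assuming a small initial error.
  have hδΔ : δ ≤ Δ := by
    refine (norm_sub_le _ _).trans (add_le_add ((hzρ 0 h0m).trans (le_abs_self _)) ?_)
    rw [← hw.apply_zero]
    exact (hwρ 0 (hsub h0m)).trans (le_abs_self _)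
  have he := hCe h h0 h1 Y w hw hR z hz hzρ
  have hp1 : h ^ (s + 1) ≤ h := by
    simpa using pow_le_pow_of_le_one h0.le h1 (by omega : 1 ≤ s + 1)
  have hp2 : h ^ (s + 1) * h ^ (s + 1) ≤ h ^ (2 * s + 1) := by
    rw [← pow_add]
    exact pow_le_pow_of_le_one h0.le h1 (by omega)
  have hp3 : h * (h ^ (s + 1) * h ^ (s + 1)) ≤ h ^ (2 * s + 1) :=
    (mul_le_of_le_one_left (by positivity) h1).trans hp2
  -- Adding `∫ G d` cancels the defect: only the resolvent residual applied to the error and the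
  -- quadratic Taylor remainder of `f` are left.
  have hψ : ∀ x ∈ Set.Icc (0 : ℝ) 1, HasDerivWithinAt
      (fun t => G t (z t - w t) + ∫ τ in (0 : ℝ)..t, G τ (d τ))
      ((G' x + h • (G x * fderiv ℝ f (w x))) (z x - w x) +
        h • G x (f (z x) - f (w x) - fderiv ℝ f (w x) (z x - w x))) (Set.Icc 0 1) x := by
    intro x hx
    have e1 := (hGd x).hasDerivWithinAt (s := Set.Icc 0 1) |>.clm_apply
      ((hz x hx).sub (hw.hasDerivAt x).hasDerivWithinAt)
    have e2 := ((by fun_prop : Continuous fun τ => G τ (d τ)).integral_hasStrictDerivAt 0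
      x).hasDerivAt.hasDerivWithinAt (s := Set.Icc 0 1)
    have e3 : (G' x + h • (G x * fderiv ℝ f (w x))) (z x - w x) +
        h • G x (f (z x) - f (w x) - fderiv ℝ f (w x) (z x - w x)) =
        G' x (z x - w x) + G x (h • f (z x) - h • legendreProj c b s (fun t => f (w t)) x) +
          G x (d x) := by
      simp only [hdd, stepDefect, add_apply, smul_apply, mul_apply_eq_comp,
        map_sub, map_smul, smul_sub]
      abel
    rw [e3]
    exact e1.add e2
  have hbound : ∀ x ∈ Set.Ico (0 : ℝ) 1,
      ‖(G' x + h • (G x * fderiv ℝ f (w x))) (z x - w x) +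
        h • G x (f (z x) - f (w x) - fderiv ℝ f (w x) (z x - w x))‖ ≤
      Cg * h ^ (s + 1) * (Ce * (δ + h ^ (s + 1))) +
        h * (Cg * (Q * (Ce * (δ + h ^ (s + 1))) ^ 2)) := by
    intro x hx
    have hx : x ∈ Set.Icc (0 : ℝ) 1 := ⟨hx.1, hx.2.le⟩
    have hxL := hsub hx
    refine (norm_add_le _ _).trans (add_le_add ?_ ?_)
    · exact (ContinuousLinearMap.le_opNorm _ _).trans
        (mul_le_mul (hGres x hxL) (he x hx) (norm_nonneg _) (by positivity))
    · rw [norm_smul, Real.norm_of_nonneg h0.le]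
      refine mul_le_mul_of_nonneg_left ?_ h0.le
      refine (ContinuousLinearMap.le_opNorm _ _).trans
        (mul_le_mul (hG0 x hxL) ?_ (norm_nonneg _) hCg0)
      refine (hQ (w x) (z x) (le_max_of_le_right (hwρ x hxL))
        (le_max_of_le_left (hzρ x hx))).trans ?_
      have := he x hx
      gcongr
  have hmv := norm_image_sub_le_of_norm_deriv_le_segment_01' hψ hbound
  have hGdiff : ‖G 0 - 1‖ ≤ Cg * h := by
    have e1 := (convex_Icc (0 : ℝ) 1).norm_image_sub_le_of_norm_hasDerivWithin_le
      (C := Cg * h) (fun x _ => (hGd x).hasDerivWithinAt) (fun x hx => by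
        have := hGb x (hsub hx) 1 hs
        rwa [iteratedDeriv_one, (hGd x).deriv, pow_one] at this)
      (⟨zero_le_one, le_rfl⟩ : (1 : ℝ) ∈ Set.Icc (0 : ℝ) 1) h0m
    simpa [hG1] using e1
  have hsplit : (z 1 - w 1) - (z 0 - Y) =
      ((G 1 (z 1 - w 1) + ∫ τ in (0 : ℝ)..1, G τ (d τ)) -
        (G 0 (z 0 - w 0) + ∫ τ in (0 : ℝ)..0, G τ (d τ))) +
      (G 0 - 1) (z 0 - Y) - ∫ τ in (0 : ℝ)..1, G τ (d τ) := by
    rw [hG1, hw.apply_zero, intervalIntegral.integral_same, sub_apply,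
      one_apply_eq_self, one_apply_eq_self]
    abel
  have hfin : ‖(z 1 - w 1) - (z 0 - Y)‖ ≤
      (Cg * h ^ (s + 1) * (Ce * (δ + h ^ (s + 1))) +
        h * (Cg * (Q * (Ce * (δ + h ^ (s + 1))) ^ 2))) + Cg * h * δ + Cd * h ^ (2 * s + 1) := by
    rw [hsplit]
    refine (norm_sub_le _ _).trans (add_le_add ((norm_add_le _ _).trans
      (add_le_add hmv ?_)) hint)
    exact (ContinuousLinearMap.le_opNorm _ _).trans (mul_le_mul_of_nonneg_right hGdiff hδ0)
  refine hfin.trans ?_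
  set H := h ^ (2 * s + 1) with hH
  have hH0 : 0 ≤ H := by positivity
  have f1 : Cg * h ^ (s + 1) * (Ce * (δ + h ^ (s + 1))) ≤ Cg * Ce * (h * δ + H) := by
    have : h ^ (s + 1) * (δ + h ^ (s + 1)) ≤ h * δ + H := by
      rw [mul_add]
      gcongr
    calc _ = Cg * Ce * (h ^ (s + 1) * (δ + h ^ (s + 1))) := by ring
      _ ≤ _ := by gcongr
  have f2 : h * (Cg * (Q * (Ce * (δ + h ^ (s + 1))) ^ 2)) ≤
      2 * Cg * Q * Ce ^ 2 * (Δ + 1) * (h * δ + H) := by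
    have g1 : (δ + h ^ (s + 1)) ^ 2 ≤ 2 * (δ * δ + h ^ (s + 1) * h ^ (s + 1)) := by
      nlinarith [sq_nonneg (δ - h ^ (s + 1))]
    have g2 : h * (δ + h ^ (s + 1)) ^ 2 ≤ 2 * ((Δ + 1) * (h * δ + H)) := by
      have g3 : h * (δ * δ) ≤ Δ * (h * δ) := by
        calc h * (δ * δ) = δ * (h * δ) := by ring
          _ ≤ Δ * (h * δ) := by gcongr
      have g4 := mul_le_mul_of_nonneg_left g1 h0.le
      have g5 : 0 ≤ h * δ := by positivity
      have g6 : 0 ≤ Δ * H := mul_nonneg (by positivity) hH0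
      linarith
    calc _ = Cg * Q * Ce ^ 2 * (h * (δ + h ^ (s + 1)) ^ 2) := by ring
      _ ≤ Cg * Q * Ce ^ 2 * (2 * ((Δ + 1) * (h * δ + H))) := by gcongr
      _ = _ := by ring
  have f3 : Cg * h * δ + Cd * H ≤ (Cg + Cd) * (h * δ + H) := by
    have : 0 ≤ Cg * H := by positivity
    have : 0 ≤ Cd * (h * δ) := by positivity
    linarith
  calc _ ≤ Cg * Ce * (h * δ + H) + 2 * Cg * Q * Ce ^ 2 * (Δ + 1) * (h * δ + H) +
        (Cg + Cd) * (h * δ + H) := by linarith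
    _ = _ := by ring

end OneStep

/-! ### Existence of steps -/

section Existence

variable {E : Type*} [NormedAddCommGroup E] [NormedSpace ℝ E] [ProperSpace E] {k : ℕ}

/-- The stages are a fixed point of `W ↦ Y + h F(W)`, a contraction of the unit ball about the
constant tuple `Y`; they determine the whole polynomial. -/
theorem exists_isStep {f : E → E} (hf : ContDiff ℝ 1 f) (c b : Fin k → ℝ) (s : ℕ) (ρ : ℝ) :
    ∃ h₁ > 0, ∀ h : ℝ, 0 < h → h ≤ h₁ → ∀ Y : E, ‖Y‖ ≤ ρ →
      ∃ w, IsStep f c b s h Y w ∧ ∀ i, ‖w (c i)‖ ≤ ρ + 1 := by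
  set g : ℝ → (Fin k → E) → E := fun x W => ∑ j ∈ Finset.range s,
    (∫ τ in (0 : ℝ)..x, (legendreP j).eval τ) •
      ∑ i, (b i * (legendreP j).eval (c i)) • f (W i) with hg
  set F : (Fin k → E) → (Fin k → E) := fun W l => g (c l) W with hF
  have hFc : ContDiff ℝ 1 F := by
    rw [contDiff_pi]
    intro l
    simp only [hF, hg]
    exact ContDiff.sum fun j _ => ContDiff.const_smul _ (ContDiff.sum fun i _ =>
      ContDiff.const_smul _ (hf.comp (contDiff_apply ℝ E i)))
  obtain ⟨M, hM0, hM⟩ := exists_norm_le_of_continuous hFc.continuous (ρ + 1)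
  obtain ⟨K, hK0, hK⟩ := exists_lipschitz_on_ball hFc (ρ + 1)
  -- This gives `h M ≤ 1`, so the ball is preserved, and `h K ≤ 1/2`, the contraction factor.
  refine ⟨1 / (M + 2 * K + 1), by positivity, fun h h0 hh Y hY => ?_⟩
  rw [le_div_iff₀ (by positivity)] at hh
  have hhM : h * M ≤ 1 := by nlinarith [mul_nonneg h0.le hK0]
  have hhK : h * K ≤ 1 / 2 := by nlinarith [mul_nonneg h0.le hM0]
  set Φ : (Fin k → E) → (Fin k → E) := fun W => (fun _ => Y) + h • F W with hΦ
  set S := Metric.closedBall (fun _ => Y : Fin k → E) 1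
  have hS : ∀ W ∈ S, ‖W‖ ≤ ρ + 1 := fun W hW => by
    have h1 : ‖W - fun _ => Y‖ ≤ 1 := by simpa [S, dist_eq_norm] using hW
    have h2 : ‖(fun _ => Y : Fin k → E)‖ ≤ ρ := (pi_norm_const_le Y).trans hY
    calc ‖W‖ = ‖(fun _ => Y) + (W - fun _ => Y)‖ := by simp
      _ ≤ ρ + 1 := (norm_add_le _ _).trans (add_le_add h2 h1)
  have hmaps : Set.MapsTo Φ S S := fun W hW => by
    rw [Metric.mem_closedBall, dist_eq_norm, hΦ, add_sub_cancel_left, norm_smul,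
      Real.norm_of_nonneg h0.le]
    exact (mul_le_mul_of_nonneg_left (hM W (hS W hW)) h0.le).trans hhM
  have hcontr : ContractingWith (1 / 2) (hmaps.restrict Φ S S) := by
    refine ⟨by rw [← NNReal.coe_lt_coe]; norm_num, LipschitzWith.of_dist_le_mul fun V W => ?_⟩
    rw [Subtype.dist_eq, Subtype.dist_eq, Set.MapsTo.val_restrict_apply,
      Set.MapsTo.val_restrict_apply, dist_eq_norm, dist_eq_norm, hΦ, add_sub_add_left_eq_sub,
      ← smul_sub, norm_smul, Real.norm_of_nonneg h0.le]
    calc h * ‖F V - F W‖ ≤ h * (K * ‖(V : Fin k → E) - W‖) :=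
          mul_le_mul_of_nonneg_left (hK _ _ (hS _ V.2) (hS _ W.2)) h0.le
      _ = h * K * ‖(V : Fin k → E) - W‖ := by ring
      _ ≤ 1 / 2 * ‖(V : Fin k → E) - W‖ := by gcongr
      _ = _ := by norm_num
  obtain ⟨W, hWS, hWfix, -⟩ := ContractingWith.exists_fixedPoint'
    (Metric.isClosed_closedBall.isComplete) hmaps hcontr
    (Metric.mem_closedBall_self zero_le_one) (edist_ne_top _ _)
  have hWc : ∀ l, Y + h • g (c l) W = W l := fun l => congrFun hWfix l
  refine ⟨fun x => Y + h • g x W, fun x => ?_, fun i => ?_⟩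
  · simp only [hWc]
    rfl
  · simp only [hWc]
    exact (norm_le_pi_norm W i).trans (hS W hWS)

end Existence

/-! ### The global error -/

/-- A discrete Gronwall lemma. The recursion is required only while the conclusion holds, so that in
the existence proof the bound at `n` may justify the step to `n + 1`. -/
theorem errors_le_of_increment_le {C h : ℝ} (hC : 0 ≤ C) (h0 : 0 < h) (p N : ℕ) {δ : ℕ → ℝ}
    (hδ0 : δ 0 = 0)
    (hδ : ∀ n < N, δ n ≤ Real.exp (C * (N * h)) * h ^ p →
      δ (n + 1) ≤ δ n + C * (h * δ n + h ^ (p + 1))) :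
    ∀ n ≤ N, δ n ≤ Real.exp (C * (N * h)) * h ^ p := by
  have hp : 0 ≤ h ^ p := by positivity
  have hmono : ∀ n ≤ N, (Real.exp (C * (n * h)) - 1) * h ^ p ≤ Real.exp (C * (N * h)) * h ^ p := by
    intro n hn
    have h1 : Real.exp (C * (n * h)) ≤ Real.exp (C * (N * h)) := by
      rw [Real.exp_le_exp]
      have : (n : ℝ) ≤ N := by exact_mod_cast hn
      gcongr
    gcongr
    linarith
  -- This sequence is a supersolution of the recursion, because `1 + C h ≤ exp(C h)`.
  have key : ∀ n ≤ N, δ n ≤ (Real.exp (C * (n * h)) - 1) * h ^ p := by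
    intro n
    induction n with
    | zero => simp [hδ0]
    | succ n ih =>
      intro hn
      have ih := ih (by omega)
      have h1 := hδ n (by omega) (ih.trans (hmono n (by omega)))
      have h2 : Real.exp (C * ((n + 1 : ℕ) * h)) = Real.exp (C * h) * Real.exp (C * (n * h)) := by
        rw [← Real.exp_add]
        congr 1
        push_cast
        ring
      have h3 : 1 + C * h ≤ Real.exp (C * h) := by
        linarith [Real.add_one_le_exp (C * h)]
      calc δ (n + 1) ≤ (1 + C * h) * δ n + C * h * h ^ p := by
            rw [pow_succ] at h1
            linarith
        _ ≤ (1 + C * h) * ((Real.exp (C * (n * h)) - 1) * h ^ p) + C * h * h ^ p := by gcongr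
        _ = ((1 + C * h) * Real.exp (C * (n * h)) - 1) * h ^ p := by ring
        _ ≤ _ := by
          rw [h2]
          gcongr
  exact fun n hn => (key n hn).trans (hmono n hn)

theorem hasDerivWithinAt_scaled {E : Type*} [NormedAddCommGroup E] [NormedSpace ℝ E] {f : E → E}
    {y : ℝ → E} {t₀ T : ℝ}
    (hy : ∀ t ∈ Set.Icc t₀ T, HasDerivWithinAt y (f (y t)) (Set.Icc t₀ T) t) {t h : ℝ}
    (h0 : 0 < h) (ht : t₀ ≤ t) (htT : t + h ≤ T) :
    (∀ x ∈ Set.Icc (0 : ℝ) 1, t + x * h ∈ Set.Icc t₀ T) ∧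
    ∀ x ∈ Set.Icc (0 : ℝ) 1, HasDerivWithinAt (fun x => y (t + x * h)) (h • f (y (t + x * h)))
      (Set.Icc 0 1) x := by
  have hmem : ∀ x ∈ Set.Icc (0 : ℝ) 1, t + x * h ∈ Set.Icc t₀ T := fun x hx =>
    ⟨by nlinarith [hx.1], by nlinarith [hx.2]⟩
  refine ⟨hmem, fun x hx => ?_⟩
  have h1 : HasDerivWithinAt (fun x : ℝ => t + x * h) h (Set.Icc 0 1) x := by
    simpa using (((hasDerivAt_id x).mul_const h).const_add t).hasDerivWithinAt
  exact (hy _ (hmem x hx)).scomp x h1 hmem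

theorem mainTheorem3 (m s k q : ℕ) (hs : 1 ≤ s) (hq : 2 * s ≤ q)
    (c b : Fin k → ℝ) (hquad : IsInterpolatoryQuadrature c b) (hord : QuadratureHasOrder c b q)
    (f : EuclideanSpace ℝ (Fin m) → EuclideanSpace ℝ (Fin m))
    (hf : ContDiff ℝ (2 * s : ℕ) f)
    (t₀ T : ℝ) (hT : t₀ < T) (y₀ : EuclideanSpace ℝ (Fin m))
    (y : ℝ → EuclideanSpace ℝ (Fin m)) (hy₀ : y t₀ = y₀)
    (hy : ∀ t ∈ Set.Icc t₀ T, HasDerivWithinAt y (f (y t)) (Set.Icc t₀ T) t) :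
    -- the method is well defined for small steps, with uniformly bounded stages
    (∃ R : ℝ, ∃ h₀ > 0, ∀ N : ℕ, 1 ≤ N → ∀ h : ℝ, h = (T - t₀) / N → h ≤ h₀ →
      ∃ u : ℕ → ℝ → EuclideanSpace ℝ (Fin m), ∃ Y : ℕ → EuclideanSpace ℝ (Fin m),
        IsNumericalSolution f c b s y₀ h N u Y ∧
        ∀ n, n < N → ∀ i, ‖u (n + 1) (c i * h)‖ ≤ R) ∧
    -- error estimates, for all numerical solutions with uniformly bounded stages
    (∀ R : ℝ, ∃ C : ℝ, ∃ h₀ > 0, ∀ N : ℕ, 1 ≤ N → ∀ h : ℝ, h = (T - t₀) / N → h ≤ h₀ →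
      ∀ (u : ℕ → ℝ → EuclideanSpace ℝ (Fin m)) (Y : ℕ → EuclideanSpace ℝ (Fin m)),
        IsNumericalSolution f c b s y₀ h N u Y →
        (∀ n, n < N → ∀ i, ‖u (n + 1) (c i * h)‖ ≤ R) →
        ‖y (t₀ + h) - Y 1‖ ≤ C * h ^ (2 * s + 1) ∧
        ∀ n, n < N →
          ‖(y (t₀ + (n + 1) * h) - Y (n + 1)) - (y (t₀ + n * h) - Y n)‖
            ≤ C * h ^ (2 * s + 1) ∧
          ∀ x ∈ Set.Icc (0 : ℝ) 1,
            ‖y (t₀ + n * h + x * h) - u (n + 1) (x * h)‖ ≤ C * h ^ (s + 1)) := by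
  have h2s : ((1 : ℕ) : WithTop ℕ∞) ≤ ((2 * s : ℕ) : WithTop ℕ∞) := by
    exact_mod_cast (by omega : 1 ≤ 2 * s)
  obtain ⟨ρ, hρ⟩ := isCompact_Icc.exists_bound_of_continuousOn
    (fun t ht => (hy t ht).continuousWithinAt)
  obtain ⟨L, hL, hc⟩ : ∃ L, 1 ≤ L ∧ ∀ i, |c i| ≤ L := by
    refine ⟨1 + ∑ i, |c i|, ?_, fun i => ?_⟩
    · have : 0 ≤ ∑ i, |c i| := Finset.sum_nonneg fun i _ => abs_nonneg (c i)
      linarith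
    linarith [Finset.single_le_sum (f := fun i => |c i|) (fun i _ => abs_nonneg (c i))
      (Finset.mem_univ i)]
  have hgrid : ∀ (N : ℕ) (h : ℝ), 1 ≤ N → h = (T - t₀) / N → 0 < h ∧ N * h = T - t₀ := by
    intro N h hN hh
    have hN' : (0 : ℝ) < N := by exact_mod_cast hN
    subst hh
    exact ⟨div_pos (by linarith) hN', by field_simp⟩
  have hscaled : ∀ (N : ℕ) (h : ℝ), 0 < h → N * h = T - t₀ → ∀ n < N,
      (∀ x ∈ Set.Icc (0 : ℝ) 1, ‖y (t₀ + n * h + x * h)‖ ≤ ρ) ∧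
      ∀ x ∈ Set.Icc (0 : ℝ) 1, HasDerivWithinAt (fun x => y (t₀ + n * h + x * h))
        (h • f (y (t₀ + n * h + x * h))) (Set.Icc 0 1) x := by
    intro N h h0 hNh n hn
    have hn' : (n : ℝ) + 1 ≤ N := by exact_mod_cast hn
    have hn0 : (0 : ℝ) ≤ n := n.cast_nonneg
    obtain ⟨h1, h2⟩ := hasDerivWithinAt_scaled hy (t := t₀ + n * h) h0 (by nlinarith)
      (by nlinarith)
    exact ⟨fun x hx => hρ _ (h1 x hx), h2⟩
  have hnorm_step : ∀ a b' : EuclideanSpace ℝ (Fin m), ∀ B, ‖a - b'‖ ≤ B → ‖a‖ ≤ ‖b'‖ + B := by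
    intro a b' B hB
    have := norm_add_le b' (a - b')
    rw [add_sub_cancel] at this
    linarith
  have hends : ∀ (n : ℕ) (h : ℝ), t₀ + n * h + 1 * h = t₀ + ((n : ℝ) + 1) * h ∧
      t₀ + n * h + 0 * h = t₀ + n * h := fun n h => ⟨by ring, by ring⟩
  constructor
  · obtain ⟨h₁, hh₁, hstep⟩ := exists_isStep (hf.of_le h2s) c b s (ρ + 1)
    obtain ⟨C, hC0, hC⟩ := exists_norm_error_increment_le hord hs hq hf hL hc (ρ + 1 + 1) ρ
    set D := Real.exp (C * (T - t₀)) with hD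
    have hD0 : 0 < D := Real.exp_pos _
    -- Grid values will stay within distance `1` of the trajectory, which lies in the ball of radius
    -- `ρ`; stages move by at most `1` more. The bound `h ≤ 1 / D` makes the global error `D h^(2s)`
    -- at most `1`.
    refine ⟨ρ + 1 + 1, min h₁ (min 1 (1 / D)), by positivity, fun N hN h hh hle => ?_⟩
    obtain ⟨h0, hNh⟩ := hgrid N h hN hh
    have hle1 : h ≤ h₁ := hle.trans (min_le_left _ _)
    have hle2 : h ≤ 1 := hle.trans ((min_le_right _ _).trans (min_le_left _ _))
    have hle3 : D * h ^ (2 * s) ≤ 1 := by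
      have e1 : h ≤ 1 / D := hle.trans ((min_le_right _ _).trans (min_le_right _ _))
      have e2 : h ^ (2 * s) ≤ h := by
        simpa using pow_le_pow_of_le_one h0.le hle2 (by omega : 1 ≤ 2 * s)
      rw [le_div_iff₀ hD0] at e1
      nlinarith
    -- The step map is made total by the value `0` outside the ball, so that the recursion can be
    -- defined before its iterates are known to stay inside.
    have hW : ∀ Y, ∃ w, ‖Y‖ ≤ ρ + 1 → IsStep f c b s h Y w ∧ ∀ i, ‖w (c i)‖ ≤ ρ + 1 + 1 := by
      intro Y
      by_cases hY : ‖Y‖ ≤ ρ + 1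
      · obtain ⟨w, hw⟩ := hstep h h0 hle1 Y hY
        exact ⟨w, fun _ => hw⟩
      · exact ⟨0, fun h => absurd h hY⟩
    choose W hW using hW
    set Y : ℕ → EuclideanSpace ℝ (Fin m) := fun n => Nat.rec y₀ (fun _ Z => W Z 1) n with hYdef
    have hYs : ∀ n, Y (n + 1) = W (Y n) 1 := fun n => rfl
    have hclose : ∀ n < N, ‖y (t₀ + n * h) - Y n‖ ≤ D * h ^ (2 * s) → ‖Y n‖ ≤ ρ + 1 := by
      intro n hn hle
      have e1 := (hscaled N h h0 hNh n hn).1 0 ⟨le_rfl, zero_le_one⟩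
      rw [(hends n h).2] at e1
      rw [norm_sub_rev] at hle
      exact (hnorm_step _ _ _ (hle.trans hle3)).trans (by linarith)
    -- Bootstrap: the error bound at `n` puts `Y n` in the ball, hence `W (Y n)` is a genuine step
    -- and the increment estimate applies.
    have herr := errors_le_of_increment_le hC0 h0 (2 * s) N (δ := fun n => ‖y (t₀ + n * h) - Y n‖)
      (by simp [hYdef, hy₀]) (fun n hn hle => by
        rw [hNh] at hle
        obtain ⟨hst, hstR⟩ := hW (Y n) (hclose n hn hle)
        obtain ⟨hz1, hz2⟩ := hscaled N h h0 hNh n hn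
        have e1 := hC h h0 hle2 (Y n) _ hst hstR _ hz2 hz1
        rw [(hends n h).1, (hends n h).2, ← hYs] at e1
        push_cast
        exact hnorm_step _ _ _ e1)
    rw [hNh] at herr
    have hall : ∀ n < N, ‖Y n‖ ≤ ρ + 1 := fun n hn => hclose n hn (herr n hn.le)
    -- The shift by one is due to `u (n + 1)` being the step that starts from `Y n`.
    refine ⟨fun n t => W (Y (n - 1)) (t / h), Y, ⟨rfl, fun n hn x => ?_, fun n hn => ?_⟩,
      fun n hn i => ?_⟩
    · have e1 := (hW (Y n) (hall n hn)).1 x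
      simpa [gammaHat, h0.ne'] using e1
    · simp [hYs, h0.ne']
    · have e1 := (hW (Y n) (hall n hn)).2 i
      simpa [h0.ne'] using e1
  · intro R
    obtain ⟨C₁, hC₁0, hC₁⟩ := exists_norm_error_increment_le hord hs hq hf hL hc R ρ
    obtain ⟨C₂, hC₂0, hC₂⟩ := exists_norm_sub_step_le hord hs hq hf hL hc R ρ
    set D := Real.exp (C₁ * (T - t₀)) with hD
    have hD0 : 0 < D := Real.exp_pos _
    refine ⟨max (C₁ * (D + 1)) (C₂ * (D + 1)), 1, one_pos, fun N hN h hh hle u Y hsol hR => ?_⟩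
    obtain ⟨h0, hNh⟩ := hgrid N h hN hh
    have hst : ∀ n, n < N → IsStep f c b s h (Y n) (fun x => u (n + 1) (x * h)) :=
      fun n hn x => hsol.local_eq n hn x
    have hinc : ∀ n < N, ‖(y (t₀ + (n + 1) * h) - Y (n + 1)) - (y (t₀ + n * h) - Y n)‖ ≤
        C₁ * (h * ‖y (t₀ + n * h) - Y n‖ + h ^ (2 * s + 1)) := by
      intro n hn
      obtain ⟨hz1, hz2⟩ := hscaled N h h0 hNh n hn
      have e1 := hC₁ h h0 hle (Y n) _ (hst n hn) (hR n hn) _ hz2 hz1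
      rwa [(hends n h).1, (hends n h).2, one_mul, ← hsol.grid_eq n hn] at e1
    have he0 : y (t₀ + (0 : ℕ) * h) - Y 0 = 0 := by simp [hsol.initial, hy₀]
    have herr := errors_le_of_increment_le hC₁0 h0 (2 * s) N (δ := fun n => ‖y (t₀ + n * h) - Y n‖)
      (by rw [he0, norm_zero]) (fun n hn _ => by
        push_cast
        exact hnorm_step _ _ _ (hinc n hn))
    rw [hNh] at herr
    -- The global bound `D h^(2s)` turns the term `h |e(0)|` of the increment into `D h^(2s+1)`.
    have hinc' : ∀ n < N, ‖(y (t₀ + (n + 1) * h) - Y (n + 1)) - (y (t₀ + n * h) - Y n)‖ ≤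
        max (C₁ * (D + 1)) (C₂ * (D + 1)) * h ^ (2 * s + 1) := by
      intro n hn
      refine (hinc n hn).trans ?_
      have e1 := herr n hn.le
      calc C₁ * (h * ‖y (t₀ + n * h) - Y n‖ + h ^ (2 * s + 1))
          ≤ C₁ * (h * (D * h ^ (2 * s)) + h ^ (2 * s + 1)) := by gcongr
        _ = C₁ * (D + 1) * h ^ (2 * s + 1) := by ring
        _ ≤ _ := by
          gcongr
          exact le_max_left _ _
    refine ⟨?_, fun n hn => ⟨hinc' n hn, fun x hx => ?_⟩⟩
    · have e1 := hinc' 0 (by omega)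
      rw [he0, sub_zero] at e1
      simpa using e1
    · obtain ⟨hz1, hz2⟩ := hscaled N h h0 hNh n hn
      have e1 := hC₂ h h0 hle (Y n) _ (hst n hn) (hR n hn) _ hz2 hz1 x hx
      rw [(hends n h).2] at e1
      refine e1.trans ?_
      -- As `s ≥ 1`, the inherited error does not exceed the order of the local one.
      have e2 : h ^ (2 * s) ≤ h ^ (s + 1) := pow_le_pow_of_le_one h0.le hle (by omega)
      calc C₂ * (‖y (t₀ + n * h) - Y n‖ + h ^ (s + 1))
          ≤ C₂ * (D * h ^ (s + 1) + h ^ (s + 1)) := by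
            have e3 := (herr n hn.le).trans (mul_le_mul_of_nonneg_left e2 hD0.le)
            gcongr
        _ = C₂ * (D + 1) * h ^ (s + 1) := by ring
        _ ≤ _ := by
          gcongr
          exact le_max_right _ _
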